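/- Let $\eta=(\eta_1,\dots,\eta_p)$ be a composition of $n$, that is, a sequence of positive integers with $\eta_1+\cdots+\eta_p=n$. Put $r_0=0$ and $r_k=\eta_1+\cdots+\eta_k$. Let $\Phi(\eta)$ be the set of pairs $(i,j)$ of integers such that $1\le i\le r_k<j\le n$ for some $1\le k\le p$. The polynomials $K_{\Phi(\eta)}(\gamma|q)\in\mathbb{Z}[q]$, $\gamma\in\mathbb{Z}^n$, are defined by the expansion $$\prod_{(i,j)\in\Phi(\eta)}\Bigl(1-q\,\frac{x_i}{x_j}\Bigr)^{-1}=\sum_{\gamma}K_{\Phi(\eta)}(\gamma|q)\,x^{\gamma}$$ (each factor is expanded as a power series in $q$), and $K_{\Phi(\eta)}(\gamma):=K_{\Phi(\eta)}(\gamma|1)$. Let $Y_\eta$ be the set of $\gamma\in\mathbb{Z}^n$ with $\gamma_1+\cdots+\gamma_n=0$ such that $$\sum_{j=1}^{r_k}\gamma_j+\sum_{a\in\Omega}\gamma_a\ge 0\quad\text{for all } 0\le k\le p-1 \text{ and all } \Omega\subseteq\{r_k+1,\dots,r_{k+1}\}.$$ Theorem. Let $\gamma\in Y_\eta$. Then $$\sum_{N\ge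 0}K_{\Phi(\eta)}(N\gamma|q)\,t^N=\frac{P(q,t)}{Q(q,t)},$$ where $P,Q\in\mathbb{Z}[q,t]$ have no common factor other than units, $P(0,0)=1$, and moreover: (1) $Q(q,t)=\prod_{j\in J}(1-q^j t)$ for some finite multiset $J$ of non-negative integers; (2) $P(1,t)=(1-t)^{s}\,\tilde P(t)$ for some integer $s\ge 0$ and some polynomial $\tilde P(t)$ with non-negative integer coefficients and $\tilde P(1)\ne 0$. Furthermore, there is a polynomial $\mathcal{K}(t)$ with rational coefficients such that $\mathcal{K}(N)=K_{\Phi(\eta)}(N\gamma)$ for all integers $N\ge 1$. -/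

import Mathlib

open Polynomial

noncomputable section

namespace ParabolicKostant

/-- The set `Φ(η)` of pairs `(i, j)` with `i ≤ η₁ + ⋯ + η_r < j` (one-based `i, j`) for some
`1 ≤ r ≤ p`. The indices are shifted here to `0, …, n - 1`. A `Composition n` is a finite sequence
of positive integers with sum `n`, and `η.sizeUpTo r = η₁ + ⋯ + η_r`. -/
def Phi {n : ℕ} (η : Composition n) : Set (Fin n × Fin n) :=
  {e | ∃ r : ℕ, 1 ≤ r ∧ r ≤ η.length ∧ (e.1 : ℕ) < η.sizeUpTo r ∧ η.sizeUpTo r ≤ (e.2 : ℕ)}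

open Classical in
/-- `Φ(η)` as a finite set. -/
def PhiFinset {n : ℕ} (η : Composition n) : Finset (Fin n × Fin n) :=
  Finset.univ.filter (fun e => e ∈ Phi η)

/-- The ring of integral Laurent polynomials in `x_1, …, x_n`; the exponent of a monomial is a
vector in `ℤⁿ`. -/
abbrev Laurent (n : ℕ) : Type := AddMonoidAlgebra ℤ (Fin n → ℤ)

/-- The Laurent monomial `x_i / x_j`. -/
def ratio {n : ℕ} (e : Fin n × Fin n) : Laurent n :=
  AddMonoidAlgebra.single (Pi.single e.1 1 - Pi.single e.2 1) 1

/-- The product `∏_{(i,j) ∈ Φ(η)} (1 - q x_i / x_j)`, as a power series in `q` over the Laurent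
polynomials. -/
def rootProduct {n : ℕ} (η : Composition n) : PowerSeries (Laurent n) :=
  ∏ e ∈ PhiFinset η, (1 - PowerSeries.C (ratio e) * PowerSeries.X)

/-- The inverse `∏_{(i,j) ∈ Φ(η)} (1 - q x_i / x_j)⁻¹`. -/
def kostantSeries {n : ℕ} (η : Composition n) : PowerSeries (Laurent n) :=
  PowerSeries.invOfUnit (rootProduct η) 1

theorem constantCoeff_rootProduct {n : ℕ} (η : Composition n) :
    PowerSeries.constantCoeff (rootProduct η) = 1 := by
  simp [rootProduct, map_prod]

theorem rootProduct_mul_kostantSeries {n : ℕ} (η : Composition n) :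
    rootProduct η * kostantSeries η = 1 :=
  PowerSeries.mul_invOfUnit _ _ (by simp [constantCoeff_rootProduct])

/-- The linear form `γ ↦ -∑ i γ_i`; it takes a value `≥ 1` at every exponent of `x_i / x_j`,
`i < j`. -/
def height {n : ℕ} (γ : Fin n → ℤ) : ℤ := -∑ i : Fin n, ((i : ℕ) : ℤ) * γ i

theorem height_add {n : ℕ} (γ δ : Fin n → ℤ) : height (γ + δ) = height γ + height δ := by
  simp [height, mul_add, Finset.sum_add_distrib]; ring

theorem height_ratio {n : ℕ} (e : Fin n × Fin n) :
    height (Pi.single e.1 1 - Pi.single e.2 1) = ((e.2 : ℕ) : ℤ) - ((e.1 : ℕ) : ℤ) := by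
  simp [height, mul_sub, Finset.sum_sub_distrib, Pi.single_apply]

/-- The Laurent polynomials all of whose exponents have height at least `a`. -/
def heightGE {n : ℕ} (a : ℤ) : AddSubgroup (Laurent n) where
  carrier := {f | ∀ γ, f.coeff γ ≠ 0 → a ≤ height γ}
  zero_mem' := by intro γ h; simp at h
  add_mem' := by
    intro f g hf hg γ h
    by_cases h1 : f.coeff γ = 0
    · exact hg γ (fun h2 => h (by simp [h1, h2]))
    · exact hf γ h1
  neg_mem' := by
    intro f hf γ h
    exact hf γ (fun h1 => h (by simp [h1]))

theorem mul_mem_heightGE {n : ℕ} {f g : Laurent n} {a b : ℤ}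
    (hf : f ∈ heightGE a) (hg : g ∈ heightGE b) : f * g ∈ heightGE (a + b) := by
  classical
  intro γ h
  rw [AddMonoidAlgebra.coeff_mul] at h
  obtain ⟨α, hα, h⟩ := Finset.exists_ne_zero_of_sum_ne_zero h
  obtain ⟨β, hβ, h⟩ := Finset.exists_ne_zero_of_sum_ne_zero h
  have hγ : α + β = γ := by
    by_contra hne
    simp [hne] at h
  rw [← hγ, height_add]
  exact add_le_add (hf α (Finsupp.mem_support_iff.mp hα)) (hg β (Finsupp.mem_support_iff.mp hβ))

theorem one_mem_heightGE {n : ℕ} : (1 : Laurent n) ∈ heightGE 0 := by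
  classical
  intro γ h
  rw [AddMonoidAlgebra.one_def, AddMonoidAlgebra.coeff_single] at h
  have : (0 : Fin n → ℤ) = γ := by
    by_contra hne
    simp [hne] at h
  simp [← this, height]

theorem coeff_rootProduct_mem {n : ℕ} (η : Composition n) (d : ℕ) :
    PowerSeries.coeff d (rootProduct η) ∈ heightGE (d : ℤ) := by
  classical
  have key : ∀ s ⊆ PhiFinset η, ∀ d : ℕ, PowerSeries.coeff d
      (∏ e ∈ s, (1 - PowerSeries.C (ratio e) * PowerSeries.X)) ∈ heightGE (d : ℤ) := by
    intro s
    induction s using Finset.induction_on with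
    | empty =>
      intro _ d
      rw [Finset.prod_empty, PowerSeries.coeff_one]
      split_ifs with h
      · simpa [h] using one_mem_heightGE
      · exact zero_mem _
    | insert e s hes ih =>
      intro hs d
      have hs' : s ⊆ PhiFinset η := fun x hx => hs (Finset.mem_insert_of_mem hx)
      have he : (e.1 : ℕ) < (e.2 : ℕ) := by
        have := hs (Finset.mem_insert_self e s)
        simp only [PhiFinset, Finset.mem_filter] at this
        obtain ⟨-, r, -, -, h1, h2⟩ := this
        omega
      rw [Finset.prod_insert hes, sub_mul, one_mul, map_sub]
      refine sub_mem (ih hs' d) ?_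
      rw [mul_assoc, PowerSeries.coeff_C_mul]
      cases d with
      | zero => simp [zero_mem]
      | succ d =>
        rw [mul_comm PowerSeries.X, PowerSeries.coeff_succ_mul_X]
        have h1 : ratio e ∈ heightGE (n := n) 1 := by
          intro γ h
          rw [ratio, AddMonoidAlgebra.coeff_single] at h
          have : Pi.single e.1 1 - Pi.single e.2 1 = γ := by
            by_contra hne
            simp [hne] at h
          rw [← this, height_ratio]
          omega
        have := mul_mem_heightGE h1 (ih hs' d)
        rwa [add_comm, ← Nat.cast_succ] at this
  exact key _ subset_rfl d

theorem coeff_kostantSeries_mem {n : ℕ} (η : Composition n) (d : ℕ) :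
    PowerSeries.coeff d (kostantSeries η) ∈ heightGE (d : ℤ) := by
  induction d using Nat.strong_induction_on with
  | _ d ih =>
    rw [kostantSeries, PowerSeries.coeff_invOfUnit]
    split_ifs with h
    · simpa [h] using one_mem_heightGE
    · simp only [inv_one, Units.val_one, neg_mul, one_mul]
      refine neg_mem (sum_mem fun x hx => ?_)
      split_ifs with h2
      · have h3 := mul_mem_heightGE (coeff_rootProduct_mem η x.1) (ih x.2 h2)
        rw [← Nat.cast_add, Finset.HasAntidiagonal.mem_antidiagonal.mp hx] at h3
        exact h3
      · exact zero_mem _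

/-- The parabolic `q`-Kostant partition function `K_{Φ(η)}(γ|q)`: the polynomial in `q` whose
coefficient at `q^d` is the coefficient of `q^d x^γ` in `∏_{(i,j) ∈ Φ(η)} (1 - q x_i / x_j)⁻¹`.
The degrees `d > height γ`, where these coefficients vanish, are cut off;
`coeff_qKostant` shows that nothing is lost. -/
def qKostant {n : ℕ} (η : Composition n) (γ : Fin n → ℤ) : ℤ[X] :=
  ∑ d ∈ Finset.range ((height γ).toNat + 1),
    Polynomial.monomial d ((PowerSeries.coeff d (kostantSeries η)).coeff γ)

theorem coeff_qKostant {n : ℕ} (η : Composition n) (γ : Fin n → ℤ) (d : ℕ) :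
    (qKostant η γ).coeff d = (PowerSeries.coeff d (kostantSeries η)).coeff γ := by
  simp only [qKostant, Polynomial.finsetSum_coeff, Polynomial.coeff_monomial,
    Finset.sum_ite_eq', Finset.mem_range]
  split_ifs with h
  · rfl
  · by_contra hne
    have := coeff_kostantSeries_mem η d γ (Ne.symm hne)
    omega

/-- The parabolic Kostant partition function `K_{Φ(η)}(γ)`, the value of `K_{Φ(η)}(γ|q)` at
`q = 1`. -/
def kostant {n : ℕ} (η : Composition n) (γ : Fin n → ℤ) : ℤ :=
  (qKostant η γ).eval 1

/-- The set `Y_η`: integer vectors with zero sum such that, for each block `k` of `η`, the sum of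
all the entries before that block plus the entries at any subset `Ω` of the positions of that
block is non-negative. -/
def Y {n : ℕ} (η : Composition n) : Set (Fin n → ℤ) :=
  {γ | ∑ i, γ i = 0 ∧
    ∀ k < η.length, ∀ Ω : Finset (Fin n),
      (∀ a ∈ Ω, η.sizeUpTo k ≤ (a : ℕ) ∧ (a : ℕ) < η.sizeUpTo (k + 1)) →
      0 ≤ (∑ j ∈ Finset.univ.filter (fun j : Fin n => (j : ℕ) < η.sizeUpTo k), γ j) + ∑ a ∈ Ω, γ a}

/-- The generating series `∑_{N ≥ 0} K_{Φ(η)}(Nγ|q) t^N`, a power series in `t` over `ℤ[q]`. -/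
def stretchedSeries {n : ℕ} (η : Composition n) (γ : Fin n → ℤ) : PowerSeries ℤ[X] :=
  PowerSeries.mk fun N => qKostant η (N • γ)

end ParabolicKostant

end

/-! Expanding the geometric series, the coefficient of `q ^ d` in `K(Nγ|q)` counts non-negative
integral flows of total value `d` and net flow `Nγ` in the graph with edge set `Φ(η)`. So the
stretched series enumerates the lattice points `(N, m)` of a cone, with `t` recording the scale `N`
and `q` the total of `m` (`stretchedSeries_eq_latticeSeries`). Since every edge goes from a smaller
to a larger index, the slices of fixed scale are bounded.

The cone is cut by the hyperplanes `m e = j N` into cones over polytopes `a e ≤ m e / N ≤ a e + 1`.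
A rational flow can be rounded to an integral one without crossing any integral bound
(`exists_integral_flow`), so every non-zero face of such a cone contains a lattice point of scale
one, at which each defining form is `0` or `1`. Pulling at such points decomposes the cone into
unimodular simplicial cones (`latticeSeries_halfOpenCone_mem`). A generic sequence `p` decides which
piece owns each common wall, so the decomposition is disjoint and no inclusion-exclusion signs
appear. Each piece, of the same dimension `D`, contributes `q ^ b t ^ a / ∏ (1 - q ^ j t)` with `D`
factors and `a ≤ D` (`latticeSeries_flowCone_mem`).

Everything follows from this shape. Over a common denominator the series is rational, and
irreducible factors `1 - q ^ j t` can be cancelled until the fraction is reduced. At `q = 1` the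
pieces add up to `h(t) / (1 - t) ^ D` with `h` having non-negative coefficients, so `h(1) ≠ 0`;
comparison with the reduced denominator gives `P(1, t) = (1 - t) ^ s h(t)`. The bound `a ≤ D` makes
the coefficients of `t ^ a / (1 - t) ^ D` polynomial in `N` from `N = 1` on. -/

noncomputable section

namespace ParabolicKostant

open Filter

/-! ### Series of half-open unimodular cones -/

/-- The factor `1 - q ^ j t`. -/
def geomFactor (j : ℕ) : PowerSeries ℤ[X] :=
  1 - PowerSeries.C (X ^ j : ℤ[X]) * PowerSeries.X

theorem geomFactor_mul_inv (j : ℕ) :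
    geomFactor j * PowerSeries.invOfUnit (geomFactor j) 1 = 1 :=
  PowerSeries.mul_invOfUnit _ _ (by simp [geomFactor])

/-- Finite sums of series `q ^ b t ^ a / ∏_{j ∈ σ} (1 - q ^ j t)` with `|σ| = D` and `a ≤ D`. -/
def shellSeries (D : ℕ) : AddSubmonoid (PowerSeries ℤ[X]) :=
  AddSubmonoid.closure {H | ∃ (σ : Multiset ℕ) (a b : ℕ), Multiset.card σ = D ∧ a ≤ D ∧
    (σ.map geomFactor).prod * H = PowerSeries.C (X ^ b : ℤ[X]) * PowerSeries.X ^ a}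

theorem one_mem_shellSeries : (1 : PowerSeries ℤ[X]) ∈ shellSeries 0 :=
  AddSubmonoid.subset_closure ⟨0, 0, 0, by simp⟩

/-- The factor `1 - q ^ j t` is invertible, so `G` is determined by `H`. Adding one generator to a
cone adds one denominator factor and at most one power of `t`, which preserves `a ≤ D`. -/
theorem shellSeries_succ {D : ℕ} {G H : PowerSeries ℤ[X]} (hH : H ∈ shellSeries D) {j b ε : ℕ}
    (hε : ε ≤ 1)
    (hG : geomFactor j * G = PowerSeries.C (X ^ b : ℤ[X]) * PowerSeries.X ^ ε * H) :
    G ∈ shellSeries (D + 1) := by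
  have key : ∀ H ∈ shellSeries D, PowerSeries.invOfUnit (geomFactor j) 1 *
      (PowerSeries.C (X ^ b : ℤ[X]) * PowerSeries.X ^ ε * H) ∈ shellSeries (D + 1) := by
    intro H hH
    induction hH using AddSubmonoid.closure_induction with
    | mem H h =>
      obtain ⟨σ, a, c, h1, h2, h3⟩ := h
      refine AddSubmonoid.subset_closure ⟨j ::ₘ σ, a + ε, b + c, by simp [h1], by omega, ?_⟩
      rw [Multiset.map_cons, Multiset.prod_cons]
      calc _ = (geomFactor j * PowerSeries.invOfUnit (geomFactor j) 1) *
            (PowerSeries.C (X ^ b : ℤ[X]) * PowerSeries.X ^ ε) *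
            ((σ.map geomFactor).prod * H) := by ring
        _ = _ := by rw [geomFactor_mul_inv, h3, pow_add, pow_add, map_mul]; ring
    | zero => simp
    | add x y _ _ hx hy => rw [mul_add, mul_add]; exact add_mem hx hy
  have := key H hH
  rwa [← hG, ← mul_assoc, mul_comm (PowerSeries.invOfUnit _ _), geomFactor_mul_inv,
    one_mul] at this

/-! ### Enumerating lattice points by degree and weight -/

section LatticeSeries

variable {V : Type*} [AddCommGroup V] (deg w : V →ₗ[ℤ] ℤ)

/-- The series `∑_{x ∈ S} q ^ (w x) t ^ (deg x)`. -/
def latticeSeries (S : Set V) : PowerSeries ℤ[X] :=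
  PowerSeries.mk fun N => ∑ᶠ x ∈ {x ∈ S | deg x = N}, (X ^ (w x).toNat : ℤ[X])

/-- The conditions under which `latticeSeries deg w S` enumerates the whole of `S`. -/
structure Enumerable (S : Set V) : Prop where
  finite : ∀ N : ℕ, {x ∈ S | deg x = N}.Finite
  deg_nonneg : ∀ x ∈ S, 0 ≤ deg x
  w_nonneg : ∀ x ∈ S, 0 ≤ w x

variable {deg w}

theorem Enumerable.mono {S T : Set V} (hT : Enumerable deg w T) (h : S ⊆ T) :
    Enumerable deg w S :=
  ⟨fun N => (hT.finite N).subset fun _ hx => ⟨h hx.1, hx.2⟩,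
    fun x hx => hT.deg_nonneg x (h hx), fun x hx => hT.w_nonneg x (h hx)⟩

theorem latticeSeries_empty : latticeSeries deg w (∅ : Set V) = 0 := by
  ext1 N; simp [latticeSeries]

theorem latticeSeries_zero : latticeSeries deg w ({0} : Set V) = 1 := by
  ext1 N
  rw [latticeSeries, PowerSeries.coeff_mk, PowerSeries.coeff_one]
  split_ifs with h
  · have : {x ∈ ({0} : Set V) | deg x = (N : ℤ)} = {0} := by
      ext x; simp only [Set.mem_singleton_iff, Set.mem_ofPred_eq]
      constructor
      · exact fun h => h.1
      · rintro rfl; simp [h]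
    rw [this, finsum_mem_singleton]; simp
  · have : {x ∈ ({0} : Set V) | deg x = (N : ℤ)} = ∅ := by
      ext x; simp only [Set.mem_singleton_iff, Set.mem_ofPred_eq, Set.mem_empty_iff_false, iff_false]
      rintro ⟨rfl, h'⟩
      simp at h'; omega
    rw [this, finsum_mem_empty]

theorem latticeSeries_iUnion {κ : Type*} [Finite κ] {S : κ → Set V}
    (hS : ∀ k, Enumerable deg w (S k)) (hd : Pairwise (Function.onFun Disjoint S)) :
    latticeSeries deg w (⋃ k, S k) = ∑ᶠ k, latticeSeries deg w (S k) := by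
  ext1 N
  have h1 : {x ∈ ⋃ k, S k | deg x = (N : ℤ)} = ⋃ k, {x ∈ S k | deg x = (N : ℤ)} := by
    ext x; simp
  have := Fintype.ofFinite κ
  rw [finsum_eq_sum_of_fintype, map_sum]
  simp only [latticeSeries, PowerSeries.coeff_mk]
  rw [h1, finsum_mem_iUnion, finsum_eq_sum_of_fintype]
  · intro a b hab
    exact (hd hab).mono (fun _ h => h.1) (fun _ h => h.1)
  · exact fun k => (hS k).finite N

theorem latticeSeries_union {S T : Set V} (hS : Enumerable deg w S) (hT : Enumerable deg w T)
    (hd : Disjoint S T) :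
    latticeSeries deg w (S ∪ T) = latticeSeries deg w S + latticeSeries deg w T := by
  ext1 N
  rw [map_add]
  simp only [latticeSeries, PowerSeries.coeff_mk]
  have h1 : {x ∈ S ∪ T | deg x = (N : ℤ)} = {x ∈ S | deg x = (N : ℤ)} ∪
      {x ∈ T | deg x = (N : ℤ)} := by
    ext x; simp [or_and_right]
  rw [h1, finsum_mem_union _ (hS.finite N) (hT.finite N)]
  exact hd.mono (fun _ h => h.1) (fun _ h => h.1)

/-- Both non-negativity conditions on `w` are needed for `Int.toNat` to be additive in the exponents
of `q`. -/
theorem latticeSeries_translate {S : Set V} (hS : Enumerable deg w S) {v : V} (hv : deg v = 1)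
    (hwv : 0 ≤ w v) :
    latticeSeries deg w ((fun x => v + x) '' S) =
      PowerSeries.C (X ^ (w v).toNat : ℤ[X]) * PowerSeries.X * latticeSeries deg w S := by
  ext1 N
  rw [mul_assoc, PowerSeries.coeff_C_mul]
  cases N with
  | zero =>
    rw [PowerSeries.coeff_zero_X_mul, mul_zero]
    simp only [latticeSeries, PowerSeries.coeff_mk]
    have : {x ∈ (fun x => v + x) '' S | deg x = ((0 : ℕ) : ℤ)} = ∅ := by
      ext x
      simp only [Set.mem_ofPred_eq, Set.mem_empty_iff_false, iff_false]
      rintro ⟨⟨y, hy, rfl⟩, h⟩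
      have := hS.deg_nonneg y hy
      simp only [map_add, hv] at h
      push_cast at h
      omega
    rw [this, finsum_mem_empty]
  | succ N =>
    rw [PowerSeries.coeff_succ_X_mul]
    simp only [latticeSeries, PowerSeries.coeff_mk]
    have : {x ∈ (fun x => v + x) '' S | deg x = ((N + 1 : ℕ) : ℤ)} =
        (fun x => v + x) '' {x ∈ S | deg x = (N : ℤ)} := by
      ext x
      simp only [Set.mem_ofPred_eq, Set.mem_image]
      constructor
      · rintro ⟨⟨y, hy, rfl⟩, h⟩
        simp only [map_add, hv] at h
        push_cast at h
        exact ⟨y, ⟨hy, by omega⟩, rfl⟩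
      · rintro ⟨y, ⟨hy, h⟩, rfl⟩
        refine ⟨⟨y, hy, rfl⟩, ?_⟩
        simp only [map_add, hv, h]
        push_cast
        ring
    rw [this, finsum_mem_image (fun a _ b _ h => by simpa using h),
      mul_finsum_mem]
    refine finsum_mem_congr rfl fun x hx => ?_
    rw [← pow_add, map_add, Int.toNat_add hwv (hS.w_nonneg x hx.1)]

/-- The set `S + ℕ v`. -/
def ray (v : V) (S : Set V) : Set V := {x | ∃ k : ℕ, ∃ y ∈ S, x = y + k • v}

/-- If the sums in `S + ℕ v` are direct, the series of `S + ℕ v` is that of `S` divided by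
`1 - q ^ (w v) t`. -/
theorem geomFactor_mul_latticeSeries_ray {S : Set V} {v : V}
    (hS : Enumerable deg w (ray v S)) (hv : deg v = 1) (hwv : 0 ≤ w v)
    (f : V →ₗ[ℤ] ℤ) (hfv : f v = 1) (hf : ∀ y ∈ S, f y = 0) :
    geomFactor (w v).toNat * latticeSeries deg w (ray v S) = latticeSeries deg w S := by
  -- The ray splits into its base and its own translate by `v`; the form `f`, zero on `S` and one at
  -- `v`, separates them.
  have h1 : ray v S = S ∪ (fun x => v + x) '' ray v S := by
    ext x
    constructor
    · rintro ⟨k, y, hy, rfl⟩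
      cases k with
      | zero => left; simpa using hy
      | succ k => exact Or.inr ⟨y + k • v, ⟨k, y, hy, rfl⟩, by simp only [succ_nsmul]; abel⟩
    · rintro (hx | ⟨_, ⟨k, y, hy, rfl⟩, rfl⟩)
      · exact ⟨0, x, hx, by simp⟩
      · exact ⟨k + 1, y, hy, by simp only [succ_nsmul]; abel⟩
  have hsub : S ⊆ ray v S := fun x hx => ⟨0, x, hx, by simp⟩
  have hd : Disjoint S ((fun x => v + x) '' ray v S) := by
    rw [Set.disjoint_left]
    rintro x hx ⟨_, ⟨k, y, hy, rfl⟩, rfl⟩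
    have := hf _ hx
    simp only [map_add, map_nsmul, hfv, hf y hy] at this
    simp at this
    omega
  have h2 := latticeSeries_union (hS.mono hsub)
    (hS.mono (by intro x hx; rw [h1]; exact Or.inr hx)) hd
  rw [← h1, latticeSeries_translate hS hv hwv] at h2
  rw [geomFactor, sub_mul, one_mul]
  linear_combination h2

end LatticeSeries

/-! ### Half-open decomposition into unimodular cones -/

section HalfOpen

variable {V : Type*} [AddCommGroup V] {ι : Type*}

/-- The half-space `g ≥ 0` without its boundary if `g` is eventually negative along `p`. -/
def HalfOpen (p : ℕ → V) (g : V →ₗ[ℤ] ℤ) (x : V) : Prop :=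
  0 ≤ g x ∧ ((∀ᶠ M in atTop, g (p M) < 0) → 0 < g x)

/-- The points of `L` in all the half-open half-spaces of a family of linear forms. -/
def halfOpenCone (L : Submodule ℤ V) (p : ℕ → V) (f : ι → V →ₗ[ℤ] ℤ) : Set V :=
  {x | x ∈ L ∧ ∀ i, HalfOpen p (f i) x}

/-- The sequence `p` in `L` eventually avoids the zeros of every form that is not zero on `L`, on
one side. -/
structure IsGeneric (L : Submodule ℤ V) (p : ℕ → V) : Prop where
  mem : ∀ M, p M ∈ L
  trichotomy : ∀ g : V →ₗ[ℤ] ℤ, (∀ᶠ M in atTop, g (p M) < 0) ∨ (∀ᶠ M in atTop, 0 < g (p M)) ∨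
    ∀ x ∈ L, g x = 0

theorem IsGeneric.eventually_nonneg {L : Submodule ℤ V} {p : ℕ → V} (hp : IsGeneric L p)
    {g : V →ₗ[ℤ] ℤ} (hg : ¬ ∀ᶠ M in atTop, g (p M) < 0) : ∀ᶠ M in atTop, 0 ≤ g (p M) := by
  rcases hp.trichotomy g with h | h | h
  · exact absurd h hg
  · exact h.mono fun _ h => h.le
  · exact Eventually.of_forall fun M => (h _ (hp.mem M)).ge

/-- The projection of `p` to `ker g` along `v`, where `g v = 1`. -/
def projSeq (g : V →ₗ[ℤ] ℤ) (v : V) (p : ℕ → V) : ℕ → V := fun M => p M - g (p M) • v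

/-- A form `h` takes on the projected sequence the values of `h - h v • g` on `p`, and the two forms
agree on `ker g`. -/
theorem IsGeneric.projSeq {L : Submodule ℤ V} {p : ℕ → V} (hp : IsGeneric L p)
    {g : V →ₗ[ℤ] ℤ} {v : V} (hv : v ∈ L) (hgv : g v = 1) :
    IsGeneric (L ⊓ LinearMap.ker g) (projSeq g v p) := by
  refine ⟨fun M => ⟨L.sub_mem (hp.mem M) (L.smul_mem _ hv), by simp [ParabolicKostant.projSeq, hgv]⟩,
    fun h => ?_⟩
  have e : ∀ M, h (ParabolicKostant.projSeq g v p M) = (h - h v • g) (p M) := fun M => by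
    simp [ParabolicKostant.projSeq, mul_comm]
  simp only [e]
  rcases hp.trichotomy (h - h v • g) with h1 | h1 | h1
  · exact Or.inl h1
  · exact Or.inr (Or.inl h1)
  · refine Or.inr (Or.inr fun x hx => ?_)
    have h2 := h1 x hx.1
    have h3 : g x = 0 := hx.2
    simpa [h3] using h2

variable [Module.Finite ℤ V] [Module.Free ℤ V]

/-- Because `g v = 1`, the lattice splits as `L = (L ∩ ker g) ⊕ ℤ v`; this is where unimodularity
enters. -/
theorem finrank_inf_ker_add_one {L : Submodule ℤ V} {g : V →ₗ[ℤ] ℤ} {v : V} (hv : v ∈ L)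
    (hgv : g v = 1) :
    Module.finrank ℤ ↥(L ⊓ LinearMap.ker g) + 1 = Module.finrank ℤ L := by
  let e : ↥L ≃ₗ[ℤ] ↥(L ⊓ LinearMap.ker g) × ℤ :=
    { toFun := fun x => (⟨x - g x • v, L.sub_mem x.2 (L.smul_mem _ hv), by simp [hgv]⟩, g x)
      invFun := fun y => ⟨y.1 + y.2 • v, L.add_mem y.1.2.1 (L.smul_mem _ hv)⟩
      map_add' := fun x y => by
        ext <;> simp [add_smul]; abel
      map_smul' := fun c x => by
        ext <;> simp [smul_sub, mul_smul]
      left_inv := fun x => by ext; simp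
      right_inv := fun y => by
        have h : g y.1 = 0 := y.1.2.2
        ext <;> simp [h, hgv] }
  rw [e.finrank_eq, Module.finrank_prod, Module.finrank_self]

variable [Finite ι]

/-- If every face of the cone `f ≥ 0` in `L` has a lattice point of degree one at which the
forms `f i` take the values `0` and `1` only, then the half-open cone has a series that is a sum of
those of half-open unimodular simplicial cones. -/
theorem latticeSeries_halfOpenCone_mem (deg w : V →ₗ[ℤ] ℤ) (f : ι → V →ₗ[ℤ] ℤ) :
    ∀ (D : ℕ) (L : Submodule ℤ V) (p : ℕ → V), Module.finrank ℤ L = D → IsGeneric L p →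
      (∀ x ∈ L, (∀ i, f i x = 0) → x = 0) →
      Enumerable deg w {x | x ∈ L ∧ ∀ i, 0 ≤ f i x} →
      (∀ T : Set ι, (∃ x ∈ L, x ≠ 0 ∧ (∀ i, 0 ≤ f i x) ∧ ∀ i ∈ T, f i x = 0) →
        ∃ v ∈ L, deg v = 1 ∧ (∀ i, f i v = 0 ∨ f i v = 1) ∧ ∀ i ∈ T, f i v = 0) →
      latticeSeries deg w (halfOpenCone L p f) ∈ shellSeries D := by
  intro D
  induction D with
  | zero =>
    intro L p hD hp hpt hen hint
    have hL : L = ⊥ := by rwa [Submodule.finrank_eq_zero] at hD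
    have : halfOpenCone L p f = {0} := by
      ext x
      simp only [halfOpenCone, Set.mem_ofPred_eq, hL, Submodule.mem_bot, Set.mem_singleton_iff,
        and_iff_left_iff_imp]
      rintro rfl i
      refine ⟨by simp, fun h => ?_⟩
      obtain ⟨M, hM⟩ := h.exists
      have := hp.mem M
      rw [hL, Submodule.mem_bot] at this
      simp [this] at hM
    rw [this, latticeSeries_zero]
    exact one_mem_shellSeries
  | succ D ih =>
    intro L p hD hp hpt hen hint
    by_cases hne : ∃ x ∈ L, x ≠ 0 ∧ ∀ i, 0 ≤ f i x
    swap
    -- The cone is `{0}`. If `0` were in the half-open cone, no form would be eventually negative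
    -- along `p`, so `p` would end up in the cone and vanish; by genericity all `f i` would then
    -- vanish on `L`, forcing rank zero.
    · push Not at hne
      have : halfOpenCone L p f = ∅ := by
        rw [Set.eq_empty_iff_forall_notMem]
        rintro x ⟨hxL, hx⟩
        have hx0 : x = 0 := by
          by_contra h
          obtain ⟨i, hi⟩ := hne x hxL h
          exact absurd (hx i).1 hi.not_ge
        subst hx0
        have h1 : ∀ᶠ M in atTop, ∀ i, 0 ≤ f i (p M) := by
          rw [eventually_all]
          intro i
          refine hp.eventually_nonneg fun h => ?_
          have := (hx i).2 h
          simp at this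
        have h2 : ∀ᶠ M in atTop, p M = 0 := h1.mono fun M hM => by
          by_contra h
          obtain ⟨i, hi⟩ := hne _ (hp.mem M) h
          exact absurd (hM i) hi.not_ge
        have hL : L = ⊥ := by
          rw [Submodule.eq_bot_iff]
          refine fun x hx => hpt x hx fun i => ?_
          rcases hp.trichotomy (f i) with h | h | h
          · obtain ⟨M, h3, h4⟩ := (h.and h2).exists; simp [h4] at h3
          · obtain ⟨M, h3, h4⟩ := (h.and h2).exists; simp [h4] at h3
          · exact h x hx
        rw [hL, finrank_bot] at hD
        omega
      rw [this, latticeSeries_empty]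
      exact zero_mem _
    obtain ⟨x₀, hx₀, hx₀', hx₀''⟩ := hne
    obtain ⟨v, hvL, hdv, hv01, -⟩ := hint ∅ ⟨x₀, hx₀, hx₀', hx₀'', by simp⟩
    have hv0 : v ≠ 0 := by rintro rfl; simp at hdv
    have hvnn : ∀ i, 0 ≤ f i v := fun i => by rcases hv01 i with h | h <;> simp [h]
    have hwv : 0 ≤ w v := hen.w_nonneg v ⟨hvL, hvnn⟩
    -- representatives of the forms with value one at `v` modulo equality on `L`
    obtain ⟨A, hAsub, hA⟩ : ∃ A ⊆ {i | f i v = 1}, Set.BijOn (fun i => (f i).domRestrict L) A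
        ((fun i => (f i).domRestrict L) '' {i | f i v = 1}) :=
      (Set.surjOn_image _ _).exists_bijOn_subset
    have hAv : ∀ i ∈ A, f i v = 1 := fun i hi => hAsub hi
    have hArep : ∀ i, f i v = 1 → ∃ j ∈ A, ∀ x ∈ L, f j x = f i x := by
      intro i hi
      obtain ⟨j, hj, hji⟩ := hA.surjOn ⟨i, hi, rfl⟩
      exact ⟨j, hj, fun x hx => by simpa using LinearMap.congr_fun hji ⟨x, hx⟩⟩
    have hAinj : ∀ i ∈ A, ∀ j ∈ A, (∀ x ∈ L, f i x = f j x) → i = j := by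
      intro i hi j hj h
      refine hA.injOn hi hj ?_
      ext x
      simpa using h x x.2
    -- the pieces
    let C : ι → Set V := fun i => halfOpenCone (L ⊓ LinearMap.ker (f i)) (projSeq (f i) v p) f
    let S : A → Set V := fun i =>
      {x | ∃ k : ℕ, ∃ y ∈ C i, x = y + k • v ∧ ((∀ᶠ M in atTop, f i (p M) < 0) → 1 ≤ k)}
    have hCf : ∀ i, ∀ y ∈ C i, f i y = 0 := fun i y hy => hy.1.2
    have hproj : ∀ i j M, f j (projSeq (f i) v p M) = f j (p M) - f i (p M) * f j v := by
      intro i j M; simp [projSeq]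
    have hCmem : ∀ i ∈ A, latticeSeries deg w (C i) ∈ shellSeries D := by
      intro i hi
      refine ih _ _ ?_ (hp.projSeq hvL (hAv i hi)) (fun x hx => hpt x hx.1)
        (hen.mono fun x hx => ⟨hx.1.1, hx.2⟩) ?_
      · have := finrank_inf_ker_add_one hvL (hAv i hi)
        omega
      · rintro T ⟨x, hx, hx0, hx1, hx2⟩
        obtain ⟨u, hu, hu1, hu2, hu3⟩ := hint (insert i T) ⟨x, hx.1, hx0, hx1, by
          rintro j (rfl | hj)
          · exact hx.2
          · exact hx2 j hj⟩
        exact ⟨u, ⟨hu, hu3 i (Set.mem_insert _ _)⟩, hu1, hu2,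
          fun j hj => hu3 j (Set.mem_insert_of_mem _ hj)⟩
    have hrayen : ∀ i, Enumerable deg w (ray v (C i)) := by
      refine fun i => hen.mono ?_
      rintro x ⟨k, y, hy, rfl⟩
      refine ⟨L.add_mem hy.1.1 (L.smul_of_tower_mem _ hvL), fun j => ?_⟩
      rw [map_add, map_nsmul]
      exact add_nonneg (hy.2 j).1 (nsmul_nonneg (hvnn j) k)
    have hSray : ∀ i : A, S i ⊆ ray v (C i) := by
      rintro i x ⟨k, y, hy, hx, -⟩
      exact ⟨k, y, hy, hx⟩
    have hSmem : ∀ i : A, latticeSeries deg w (S i) ∈ shellSeries (D + 1) := by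
      rintro ⟨i, hi⟩
      have hr := geomFactor_mul_latticeSeries_ray (hrayen i) hdv hwv (f i) (hAv i hi) (hCf i)
      by_cases hneg : ∀ᶠ M in atTop, f i (p M) < 0
      · have : S ⟨i, hi⟩ = (fun x => v + x) '' ray v (C i) := by
          ext x
          constructor
          · rintro ⟨k, y, hy, rfl, hk⟩
            obtain ⟨k, rfl⟩ := Nat.exists_eq_add_of_le' (hk hneg)
            exact ⟨y + k • v, ⟨k, y, hy, rfl⟩, by simp only [succ_nsmul]; abel⟩
          · rintro ⟨_, ⟨k, y, hy, rfl⟩, rfl⟩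
            exact ⟨k + 1, y, hy, by simp only [succ_nsmul]; abel, fun _ => by omega⟩
        rw [this, latticeSeries_translate (hrayen i) hdv hwv]
        refine shellSeries_succ (hCmem i hi) (j := (w v).toNat) (b := (w v).toNat) (ε := 1) le_rfl ?_
        rw [← hr, pow_one]
        ring
      · have : S ⟨i, hi⟩ = ray v (C i) := by
          refine (hSray _).antisymm ?_
          rintro x ⟨k, y, hy, hx⟩
          exact ⟨k, y, hy, hx, fun h => absurd h hneg⟩
        rw [this]
        refine shellSeries_succ (hCmem i hi) (j := (w v).toNat) (b := 0) (ε := 0) zero_le_one ?_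
        rw [hr]
        simp
    have hsign : ∀ i ∈ A, ∀ j ∈ A, i ≠ j → (∀ᶠ M in atTop, f i (p M) < f j (p M)) ∨
        (∀ᶠ M in atTop, f j (p M) < f i (p M)) := by
      intro i hi j hj hij
      rcases hp.trichotomy (f i - f j) with h | h | h
      · exact Or.inl (h.mono fun M hM => by simpa using hM)
      · exact Or.inr (h.mono fun M hM => by simpa using hM)
      · exact absurd (hAinj i hi j hj fun x hx => by simpa [sub_eq_zero] using h x hx) hij
    -- the pieces are disjoint
    have hlt : ∀ i ∈ A, ∀ j ∈ A, (∀ᶠ M in atTop, f i (p M) < f j (p M)) →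
        Disjoint (ray v (C i)) (ray v (C j)) := by
      intro i hi j hj hij
      rw [Set.disjoint_left]
      rintro _ ⟨k, y, hy, rfl⟩ ⟨l, z, hz, he⟩
      have h1 : 0 < f i z := by
        refine (hz.2 i).2 (hij.mono fun M hM => ?_)
        rw [hproj, hAv i hi]
        omega
      have h2 : 0 ≤ f j y := (hy.2 j).1
      have e1 := congrArg (f i) he
      have e2 := congrArg (f j) he
      simp only [map_add, map_nsmul, hAv i hi, hAv j hj, hCf i y hy, hCf j z hz] at e1 e2
      simp at e1 e2
      omega
    have hdisj : Pairwise (Function.onFun Disjoint S) := by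
      rintro ⟨i, hi⟩ ⟨j, hj⟩ hij
      refine Disjoint.mono (hSray _) (hSray _) ?_
      rcases hsign i hi j hj (fun h => hij (Subtype.ext h)) with h | h
      · exact hlt i hi j hj h
      · exact (hlt j hj i hi h).symm
    -- the pieces cover the cone
    have hcover : halfOpenCone L p f = ⋃ i, S i := by
      ext x
      rw [Set.mem_iUnion]
      constructor
      · rintro ⟨hxL, hx⟩
        have hAne : A.Nonempty := by
          by_contra hAe
          refine hv0 (hpt v hvL fun i => ?_)
          rcases hv01 i with h | h
          · exact h
          · obtain ⟨j, hj, -⟩ := hArep i h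
            exact absurd ⟨j, hj⟩ hAe
        -- From `x` one subtracts `v` until a form with value one at `v` reaches zero, so `k` is the
        -- minimum of these `f i x`. Among minimizers, the piece is the one with least `f i` along
        -- `p`; a single index `M₀` witnesses all the eventual comparisons at once.
        obtain ⟨i₀, hi₀, hmin₀⟩ := Set.exists_min_image A (fun i => f i x) A.toFinite hAne
        obtain ⟨M₀, hM₀⟩ : ∃ M₀, ∀ i j, (∀ᶠ M in atTop, f i (p M) < f j (p M)) →
            f i (p M₀) < f j (p M₀) := by
          have : ∀ᶠ M₀ in atTop, ∀ i j, (∀ᶠ M in atTop, f i (p M) < f j (p M)) →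
              f i (p M₀) < f j (p M₀) := by
            rw [eventually_all]; intro i
            rw [eventually_all]; intro j
            by_cases h : ∀ᶠ M in atTop, f i (p M) < f j (p M)
            · exact h.mono fun _ h _ => h
            · exact Eventually.of_forall fun _ h' => absurd h' h
          exact this.exists
        obtain ⟨i, ⟨hi, hix⟩, hmin⟩ := Set.exists_min_image {i ∈ A | f i x = f i₀ x}
          (fun i => f i (p M₀)) (Set.toFinite _) ⟨i₀, hi₀, rfl⟩
        have hmin1 : ∀ j, f j v = 1 → f i x ≤ f j x := by
          intro j hj
          obtain ⟨j', hj', he⟩ := hArep j hj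
          rw [← he x hxL, hix]
          exact hmin₀ j' hj'
        have hmin2 : ∀ j, f j v = 1 → (∀ᶠ M in atTop, f j (p M) < f i (p M)) →
            f i x < f j x := by
          intro j hj hji
          refine lt_of_le_of_ne (hmin1 j hj) fun heq => ?_
          obtain ⟨j', hj', he⟩ := hArep j hj
          have h1 := hmin j' ⟨hj', by rw [he x hxL, ← heq, hix]⟩
          have h2 := hM₀ j' i (hji.mono fun M hM => by rwa [he _ (hp.mem M)])
          omega
        have hk : ((f i x).toNat : ℤ) = f i x := Int.toNat_of_nonneg (hx i).1
        have hval : ∀ j, f j (x - (f i x).toNat • v) = f j x - f i x * f j v := by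
          intro j
          rw [map_sub, map_nsmul, nsmul_eq_mul, hk]
        refine ⟨⟨i, hi⟩, (f i x).toNat, x - (f i x).toNat • v, ⟨⟨L.sub_mem hxL
          (L.smul_of_tower_mem _ hvL), ?_⟩, fun j => ⟨?_, fun hj => ?_⟩⟩, by abel, fun h => ?_⟩
        · rw [SetLike.mem_coe, LinearMap.mem_ker, hval, hAv i hi]; ring
        · rw [hval]
          rcases hv01 j with h | h
          · simpa [h] using (hx j).1
          · have := hmin1 j h
            rw [h]; omega
        · rw [hval]
          simp only [hproj] at hj
          rcases hv01 j with h | h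
          · simp only [h, mul_zero, sub_zero] at hj ⊢
            exact (hx j).2 hj
          · simp only [h, mul_one, sub_neg] at hj ⊢
            have := hmin2 j h hj
            omega
        · have := (hx i).2 h
          omega
      · rintro ⟨⟨i, hi⟩, k, y, hy, rfl, hk⟩
        refine ⟨L.add_mem hy.1.1 (L.smul_of_tower_mem _ hvL), fun j => ?_⟩
        have hyj := (hy.2 j).1
        have hyj' := (hy.2 j).2
        simp only [hproj] at hyj'
        dsimp only at hk
        refine ⟨?_, fun hj => ?_⟩
        · rw [map_add, map_nsmul]
          exact add_nonneg hyj (nsmul_nonneg (hvnn j) k)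
        · rw [map_add, map_nsmul, nsmul_eq_mul]
          rcases hv01 j with h | h
          · simp only [h, mul_zero, sub_zero, add_zero] at hyj' ⊢
            exact hyj' hj
          · simp only [h, mul_one] at hyj' ⊢
            rcases Nat.eq_zero_or_pos k with rfl | hk0
            -- With `k = 0` the form `f i` is not eventually negative, so a negative `f j (p M)`
            -- lies below `f i (p M)`, and the wall `f j = 0` is already excluded from the piece.
            · have hni : ¬ ∀ᶠ M in atTop, f i (p M) < 0 := fun h => by simpa using hk h
              have := hyj' (((hp.eventually_nonneg hni).and hj).mono fun M hM => by omega)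
              simpa using this
            · omega
    rw [hcover, latticeSeries_iUnion (fun i : A => (hrayen i).mono (hSray i)) hdisj]
    have := Fintype.ofFinite A
    rw [finsum_eq_sum_of_fintype]
    exact sum_mem fun i _ => hSmem i

end HalfOpen

/-! ### Rounding rational flows to integral ones -/

section Rounding

variable {E U : Type*} [DecidableEq U]

/-- The incidence numbers of a directed graph with sources `s` and targets `t`. -/
def incidence (s t : E → U) (e : E) (u : U) : ℤ :=
  (if s e = u then 1 else 0) - if t e = u then 1 else 0

theorem sum_incidence [Fintype U] (s t : E → U) (e : E) : ∑ u, incidence s t e u = 0 := by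
  simp [incidence]

theorem incidence_ne_zero {s t : E → U} {e : E} (h : s e ≠ t e) {u : U} :
    incidence s t e u ≠ 0 ↔ u = s e ∨ u = t e := by
  unfold incidence
  by_cases h1 : s e = u <;> by_cases h2 : t e = u
  · exact absurd (h1.trans h2.symm) h
  · simp [h1, h2]
  · simp [h1, h2]
  · simp [h1, h2, Ne.symm h1, Ne.symm h2]

theorem incidence_mem {s t : E → U} {e : E} {u : U} (h : incidence s t e u ≠ 0) :
    incidence s t e u = 1 ∨ incidence s t e u = -1 := by
  unfold incidence at *
  by_cases h1 : s e = u <;> by_cases h2 : t e = u <;> simp_all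

variable [Fintype E] [Fintype U]

/-- A nonempty set of edges without leaves carries a nonzero circulation. -/
theorem exists_circulation {s t : E → U} (hst : ∀ e, s e ≠ t e) {F : Finset E} (hF : F.Nonempty)
    (hleaf : ∀ e ∈ F, ∀ u, incidence s t e u ≠ 0 → ∃ e' ∈ F, e' ≠ e ∧ incidence s t e' u ≠ 0) :
    ∃ z : E → ℚ, (∃ e, z e ≠ 0) ∧ (∀ e ∉ F, z e = 0) ∧
      ∀ u, ∑ e, z e * incidence s t e u = 0 := by
  classical
  let W : Finset U := F.image s ∪ F.image t
  have hW : ∀ u, u ∈ W ↔ ∃ e ∈ F, incidence s t e u ≠ 0 := by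
    intro u
    simp only [incidence_ne_zero (hst _), W, Finset.mem_union, Finset.mem_image]
    constructor
    · rintro (⟨e, he, rfl⟩ | ⟨e, he, rfl⟩)
      · exact ⟨e, he, Or.inl rfl⟩
      · exact ⟨e, he, Or.inr rfl⟩
    · rintro ⟨e, he, rfl | rfl⟩
      · exact Or.inl ⟨e, he, rfl⟩
      · exact Or.inr ⟨e, he, rfl⟩
  -- Double counting: every vertex met by `F` has at least two edges in `F`, every edge two ends.
  have hcard : W.card * 2 ≤ F.card * 2 := by
    refine Finset.card_mul_le_card_mul (fun u e => incidence s t e u ≠ 0) ?_ ?_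
    · intro u hu
      obtain ⟨e, he, h⟩ := (hW u).1 hu
      obtain ⟨e', he', hne, h'⟩ := hleaf e he u h
      refine Finset.one_lt_card.2 ⟨e, ?_, e', ?_, hne.symm⟩ <;>
        simp [Finset.bipartiteAbove, *]
    · intro e _
      refine (Finset.card_le_card (t := {s e, t e}) ?_).trans Finset.card_le_two
      intro u hu
      simp only [Finset.bipartiteBelow, Finset.mem_filter, incidence_ne_zero (hst _)] at hu
      simpa using hu.2
  obtain ⟨e₀, he₀⟩ := hF
  have hw₀ : s e₀ ∈ W := (hW _).2 ⟨e₀, he₀, (incidence_ne_zero (hst _)).2 (Or.inl rfl)⟩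
  -- The conservation law at one vertex follows from the others, as incidences sum to zero. Dropping
  -- it leaves `|W| - 1 < |F|` equations, hence a non-zero solution.
  let Ψ : (F → ℚ) →ₗ[ℚ] (W.erase (s e₀) → ℚ) :=
    LinearMap.pi fun u => ∑ e : F, (incidence s t e u : ℚ) • LinearMap.proj e
  have hker : LinearMap.ker Ψ ≠ ⊥ := by
    refine LinearMap.ker_ne_bot_of_finrank_lt ?_
    simp only [Module.finrank_fintype_fun_eq_card, Fintype.card_coe]
    rw [Finset.card_erase_of_mem hw₀]
    have : 0 < W.card := Finset.card_pos.2 ⟨_, hw₀⟩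
    omega
  obtain ⟨z, hz, hz0⟩ := (Submodule.ne_bot_iff _).1 hker
  let z' : E → ℚ := fun e => if h : e ∈ F then z ⟨e, h⟩ else 0
  have hz' : ∀ u, ∑ e, z' e * incidence s t e u = ∑ e : F, z e * incidence s t e u := by
    intro u
    rw [Finset.sum_coe_sort_eq_attach,
      ← Finset.sum_subset (Finset.subset_univ F) (fun e _ he => by simp [z', he]),
      ← Finset.sum_attach]
    exact Finset.sum_congr rfl fun e _ => by simp [z']
  have hzero : ∀ u, u ≠ s e₀ → ∑ e, z' e * incidence s t e u = 0 := by
    intro u hu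
    rw [hz']
    by_cases huW : u ∈ W
    · have := congrFun (LinearMap.mem_ker.1 hz) ⟨u, Finset.mem_erase.2 ⟨hu, huW⟩⟩
      simpa [Ψ, mul_comm] using this
    · refine Finset.sum_eq_zero fun e _ => ?_
      have : incidence s t e u = 0 := by
        by_contra h
        exact huW ((hW u).2 ⟨e, e.2, h⟩)
      simp [this]
  refine ⟨z', ?_, fun e he => by simp [z', he], fun u => ?_⟩
  · obtain ⟨e, he⟩ := Function.ne_iff.1 hz0
    exact ⟨e, by simpa [z'] using he⟩
  · by_cases hu : u = s e₀
    · have h1 : ∑ u, ∑ e, z' e * (incidence s t e u : ℚ) = 0 := by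
        rw [Finset.sum_comm]
        refine Finset.sum_eq_zero fun e _ => ?_
        rw [← Finset.mul_sum, ← Int.cast_sum, sum_incidence]
        simp
      rw [Finset.sum_eq_single (s e₀) (fun u _ h => hzero u h) (by simp)] at h1
      rw [hu, h1]
    · exact hzero u hu

/-- Moving a point along a direction until a first coordinate becomes integral. -/
theorem exists_step_to_integral {y z : E → ℚ} (hz : ∃ e, z e ≠ 0)
    (hyz : ∀ e, Int.fract (y e) = 0 → z e = 0) :
    ∃ ε : ℚ, (∀ e, (⌊y e⌋ : ℚ) ≤ y e + ε * z e ∧ y e + ε * z e ≤ ⌊y e⌋ + 1) ∧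
      ∃ e, Int.fract (y e) ≠ 0 ∧ Int.fract (y e + ε * z e) = 0 := by
  classical
  -- `b e` is the time at which coordinate `e`, moving with velocity `z e`, reaches an end of its
  -- unit interval; the least such time is used.
  let b : E → ℚ := fun e => if 0 < z e then (⌊y e⌋ + 1 - y e) / z e else (⌊y e⌋ - y e) / z e
  obtain ⟨e₀, he₀, hmin⟩ := Finset.exists_min_image (Finset.univ.filter fun e => z e ≠ 0) b
    (by obtain ⟨e, he⟩ := hz; exact ⟨e, by simpa using he⟩)
  have hz₀ : z e₀ ≠ 0 := by simpa using he₀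
  have hb : ∀ e, 0 ≤ b e := by
    intro e
    have h1 := Int.floor_le (y e)
    have h2 := Int.lt_floor_add_one (y e)
    simp only [b]
    split_ifs with h
    · exact div_nonneg (by linarith) h.le
    · exact div_nonneg_of_nonpos (by linarith) (not_lt.1 h)
  refine ⟨b e₀, fun e => ?_, e₀, fun h => hz₀ (hyz e₀ h), ?_⟩
  · have h1 := Int.floor_le (y e)
    have h2 := Int.lt_floor_add_one (y e)
    rcases lt_trichotomy (z e) 0 with h | h | h
    · have h3 := hmin e (by simp [h.ne])
      have h4 : b e = (⌊y e⌋ - y e) / z e := by simp [b, h.le.not_gt]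
      rw [h4, le_div_iff_of_neg h] at h3
      have := mul_nonpos_of_nonneg_of_nonpos (hb e₀) h.le
      constructor <;> linarith
    · rw [h, mul_zero, add_zero]
      exact ⟨h1, h2.le⟩
    · have h3 := hmin e (by simp [h.ne'])
      have h4 : b e = (⌊y e⌋ + 1 - y e) / z e := by simp [b, h]
      rw [h4, le_div_iff₀ h] at h3
      have := mul_nonneg (hb e₀) h.le
      constructor <;> linarith
  · rw [Int.fract_eq_zero_iff]
    by_cases h : 0 < z e₀
    · have : y e₀ + b e₀ * z e₀ = ((⌊y e₀⌋ + 1 : ℤ) : ℚ) := by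
        simp only [b, h, if_true]
        rw [div_mul_cancel₀ _ hz₀]; push_cast; ring
      rw [this]; exact ⟨_, rfl⟩
    · have : y e₀ + b e₀ * z e₀ = ((⌊y e₀⌋ : ℤ) : ℚ) := by
        simp only [b, h, if_false]
        rw [div_mul_cancel₀ _ hz₀]; ring
      rw [this]; exact ⟨_, rfl⟩

/-- A rational flow with integral net flows can be rounded to an integral one with the same net
flows. -/
theorem exists_integral_flow {s t : E → U} (hst : ∀ e, s e ≠ t e) (γ : U → ℤ) (y : E → ℚ)
    (hy : ∀ u, ∑ e, y e * incidence s t e u = γ u) :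
    ∃ m : E → ℤ, (∀ u, ∑ e, m e * incidence s t e u = γ u) ∧
      ∀ e (j : ℤ), (j ≤ y e → j ≤ m e) ∧ (y e ≤ j → m e ≤ j) := by
  classical
  obtain ⟨c, hc⟩ : ∃ c, (Finset.univ.filter fun e => Int.fract (y e) ≠ 0).card = c := ⟨_, rfl⟩
  induction c using Nat.strong_induction_on generalizing y with
  | _ c ih =>
    by_cases hF : (Finset.univ.filter fun e => Int.fract (y e) ≠ 0).Nonempty
    -- Induction on the number of fractional edges. These have no leaf: if `e` were the only
    -- fractional edge at `u`, the integral net flow at `u` would make `y e` integral.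
    · obtain ⟨z, hz, hzF, hzu⟩ := exists_circulation hst hF (by
        intro e he u hu
        by_contra! hcon
        have he' : Int.fract (y e) ≠ 0 := by simpa using he
        refine he' ?_
        have h1 : ∀ e', e' ≠ e → ∃ k : ℤ, y e' * incidence s t e' u = k := by
          intro e' hne
          by_cases h : Int.fract (y e') = 0
          · obtain ⟨k, hk⟩ := Int.fract_eq_zero_iff.1 h
            exact ⟨k * incidence s t e' u, by rw [← hk]; push_cast; rfl⟩
          · exact ⟨0, by rw [hcon e' (by simpa using h) hne]; simp⟩
        choose! k hk using h1
        have h2 := hy u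
        rw [← Finset.add_sum_erase _ _ (Finset.mem_univ e),
          Finset.sum_congr rfl fun e' h => hk e' (Finset.ne_of_mem_erase h), ← Int.cast_sum] at h2
        rw [Int.fract_eq_zero_iff]
        rcases incidence_mem hu with h | h
        · rw [h] at h2
          refine ⟨γ u - ∑ e' ∈ Finset.univ.erase e, k e', ?_⟩
          push_cast at h2 ⊢
          linarith
        · rw [h] at h2
          refine ⟨- γ u + ∑ e' ∈ Finset.univ.erase e, k e', ?_⟩
          push_cast at h2 ⊢
          linarith)
      have hyz : ∀ e, Int.fract (y e) = 0 → z e = 0 := fun e he => hzF e (by simpa using he)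
      obtain ⟨ε, hε, e₁, he₁, he₁'⟩ := exists_step_to_integral hz hyz
      obtain ⟨m, hm, hm'⟩ := ih _ (by
        rw [← hc]
        refine Finset.card_lt_card (Finset.ssubset_iff_of_subset ?_ |>.2
          ⟨e₁, by simpa using he₁, by simpa using he₁'⟩)
        intro e he
        simp only [Finset.mem_filter, Finset.mem_univ, true_and] at he ⊢
        intro h
        exact he (by rw [hyz e h, mul_zero, add_zero, h])) (fun e => y e + ε * z e) (by
          intro u
          simp only [add_mul, Finset.sum_add_distrib, mul_assoc]
          rw [← Finset.mul_sum, hzu, hy]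
          simp) rfl
      refine ⟨m, hm, fun e j => ⟨fun h => (hm' e j).1 ?_, fun h => (hm' e j).2 ?_⟩⟩
      · exact le_trans (by exact_mod_cast Int.le_floor.2 h) (hε e).1
      · by_cases h0 : Int.fract (y e) = 0
        · rwa [hyz e h0, mul_zero, add_zero]
        · refine (hε e).2.trans ?_
          have : ⌊y e⌋ < j := by
            refine lt_of_le_of_ne ?_ ?_
            · exact_mod_cast (Int.floor_le (y e)).trans h
            · rintro rfl
              exact h0 (by rw [Int.fract, sub_eq_zero]; exact le_antisymm h (Int.floor_le _))
          exact_mod_cast this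
    · rw [Finset.not_nonempty_iff_eq_empty, Finset.filter_eq_empty_iff] at hF
      have hfl : ∀ e, (⌊y e⌋ : ℚ) = y e := by
        intro e
        have := not_not.1 (hF (Finset.mem_univ e))
        rw [Int.fract, sub_eq_zero] at this
        exact this.symm
      refine ⟨fun e => ⌊y e⌋, fun u => ?_, fun e j => ⟨fun h => Int.le_floor.2 h, fun h => ?_⟩⟩
      · have : ((∑ e, ⌊y e⌋ * incidence s t e u : ℤ) : ℚ) = γ u := by
          push_cast
          simp only [hfl]
          exact hy u
        exact_mod_cast this
      · rw [← hfl e] at h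
        exact_mod_cast h

end Rounding

/-! ### Generic sequences in a lattice -/

section Generic

theorem eventually_eval_pos {q : ℤ[X]} (hq : 0 < q.leadingCoeff) :
    ∀ᶠ M : ℕ in atTop, 0 < q.eval (M : ℤ) := by
  have hinj : Function.Injective (Int.castRingHom ℝ) := Int.cast_injective
  have h0 : 0 < (q.map (Int.castRingHom ℝ)).leadingCoeff := by
    rw [leadingCoeff_map_of_injective hinj]
    simpa using hq
  have h1 : ∀ᶠ x : ℝ in atTop, 0 < (q.map (Int.castRingHom ℝ)).eval x := by
    by_cases hd : 0 < (q.map (Int.castRingHom ℝ)).degree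
    · exact (tendsto_atTop_of_leadingCoeff_nonneg _ hd h0.le).eventually_gt_atTop 0
    · have h2 := eq_C_of_degree_le_zero (not_lt.1 hd)
      rw [h2, leadingCoeff_C] at h0
      rw [h2]
      exact Eventually.of_forall fun x => by simpa using h0
  refine (tendsto_natCast_atTop_atTop.eventually h1).mono fun M hM => ?_
  have h3 : (q.map (Int.castRingHom ℝ)).eval ((M : ℤ) : ℝ) = ((q.eval (M : ℤ) : ℤ) : ℝ) := by
    rw [eval_intCast_map, eq_intCast, Int.cast_id]
  rw [← Int.cast_natCast, h3] at hM
  exact_mod_cast hM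

/-- There is a generic sequence in `L` whose direction approaches that of a given vector. -/
theorem exists_isGeneric {V : Type*} [AddCommGroup V] [Module.Finite ℤ V] (L : Submodule ℤ V)
    {c : V} (hc : c ∈ L) :
    ∃ p, IsGeneric L p ∧ ∀ g : V →ₗ[ℤ] ℤ, 0 < g c → ∀ᶠ M in atTop, 0 < g (p M) := by
  obtain ⟨k, b, hb⟩ := Submodule.fg_iff_exists_fin_generating_family.1 (IsNoetherian.noetherian L)
  -- A moment curve: `g (p M)` is a polynomial in `M` with coefficients `g (b i)` and top
  -- coefficient `g c`. Its leading coefficient fixes the eventual sign, and it is zero only if `g`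
  -- kills all generators of `L`.
  let p : ℕ → V := fun M => (M ^ k : ℤ) • c + ∑ i : Fin k, (M ^ (i : ℕ) : ℤ) • b i
  let q : (V →ₗ[ℤ] ℤ) → ℤ[X] := fun g => C (g c) * X ^ k + ∑ i : Fin k, C (g (b i)) * X ^ (i : ℕ)
  have hpq : ∀ g (M : ℕ), g (p M) = (q g).eval (M : ℤ) := by
    intro g M
    simp [p, q, eval_finsetSum, mul_comm]
  have hqk : ∀ g, (q g).coeff k = g c := by
    intro g
    simp only [q, coeff_add, coeff_C_mul, coeff_X_pow, finsetSum_coeff, if_true, mul_one]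
    rw [Finset.sum_eq_zero, add_zero]
    intro i _
    rw [if_neg i.2.ne', mul_zero]
  have hqi : ∀ g (i : Fin k), (q g).coeff i = g (b i) := by
    intro g i
    simp only [q, coeff_add, coeff_C_mul, coeff_X_pow, finsetSum_coeff]
    rw [if_neg i.2.ne, Finset.sum_eq_single i]
    · simp
    · intro j _ hj
      rw [if_neg (fun h => hj (Fin.ext h.symm)), mul_zero]
    · simp
  have hqdeg : ∀ g, (q g).natDegree ≤ k := by
    intro g
    refine natDegree_add_le_of_degree_le (natDegree_C_mul_X_pow_le _ _) ?_
    exact natDegree_sum_le_of_forall_le _ _ fun i _ =>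
      (natDegree_C_mul_X_pow_le _ _).trans i.2.le
  refine ⟨p, ⟨fun M => ?_, fun g => ?_⟩, fun g hg => ?_⟩
  · refine L.add_mem (L.smul_mem _ hc) (L.sum_mem fun i _ => L.smul_mem _ ?_)
    rw [← hb]
    exact Submodule.subset_span ⟨i, rfl⟩
  · simp only [hpq]
    rcases lt_trichotomy (q g).leadingCoeff 0 with h | h | h
    · left
      have h' : 0 < (-(q g)).leadingCoeff := by rw [leadingCoeff_neg]; omega
      refine (eventually_eval_pos h').mono fun M hM => ?_
      rw [eval_neg] at hM
      omega
    · right; right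
      rw [leadingCoeff_eq_zero] at h
      have h1 : L ≤ LinearMap.ker g := by
        rw [← hb, Submodule.span_le]
        rintro _ ⟨i, rfl⟩
        rw [SetLike.mem_coe, LinearMap.mem_ker, ← hqi, h, coeff_zero]
      exact fun x hx => h1 hx
    · exact Or.inr (Or.inl (eventually_eval_pos h))
  · simp only [hpq]
    refine eventually_eval_pos ?_
    have : (q g).natDegree = k :=
      (hqdeg g).antisymm (le_natDegree_of_ne_zero (by rw [hqk]; exact hg.ne'))
    rwa [leadingCoeff, this, hqk]

end Generic

/-! ### Calculus of half-open half-spaces -/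

section HalfOpen

variable {V : Type*} [AddCommGroup V] {L : Submodule ℤ V} {p : ℕ → V}

/-- If `g + h` is eventually negative along `p` and `g` is not, genericity makes `g` eventually
non-negative, so `h` is eventually negative. -/
theorem HalfOpen.add (hp : IsGeneric L p) {g h : V →ₗ[ℤ] ℤ} {x : V} (hg : HalfOpen p g x)
    (hh : HalfOpen p h x) : HalfOpen p (g + h) x := by
  refine ⟨add_nonneg hg.1 hh.1, fun hneg => ?_⟩
  rw [LinearMap.add_apply]
  by_cases h1 : ∀ᶠ M in atTop, g (p M) < 0
  · exact add_pos_of_pos_of_nonneg (hg.2 h1) hh.1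
  · refine add_pos_of_nonneg_of_pos hg.1 (hh.2 ?_)
    refine (hneg.and (hp.eventually_nonneg h1)).mono fun M hM => ?_
    have := hM.1
    rw [LinearMap.add_apply] at this
    omega

theorem HalfOpen.smul {g : V →ₗ[ℤ] ℤ} {x : V} (hg : HalfOpen p g x) {k : ℤ} (hk : 0 ≤ k) :
    HalfOpen p (k • g) x := by
  refine ⟨mul_nonneg hk hg.1, fun hneg => ?_⟩
  simp only [LinearMap.smul_apply, smul_eq_mul] at hneg ⊢
  have hk0 : 0 < k := by
    refine lt_of_le_of_ne hk ?_
    rintro rfl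
    obtain ⟨M, hM⟩ := hneg.exists
    simp at hM
  refine mul_pos hk0 (hg.2 (hneg.mono fun M hM => ?_))
  by_contra h
  exact absurd (mul_nonneg hk (not_lt.1 h)) hM.not_ge

theorem HalfOpen.of_vanish (hp : IsGeneric L p) {g : V →ₗ[ℤ] ℤ} (hg : ∀ x ∈ L, g x = 0) {x : V}
    (hx : x ∈ L) : HalfOpen p g x := by
  refine ⟨(hg x hx).ge, fun h => ?_⟩
  obtain ⟨M, hM⟩ := h.exists
  exact absurd (hg _ (hp.mem M)) hM.ne

/-- A hyperplane that does not contain `L` cuts it in two disjoint half-open parts. -/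
theorem halfOpen_neg_iff (hp : IsGeneric L p) {g : V →ₗ[ℤ] ℤ} (hg : ¬ ∀ x ∈ L, g x = 0) (x : V) :
    HalfOpen p (-g) x ↔ ¬ HalfOpen p g x := by
  have key : ∀ h : V →ₗ[ℤ] ℤ, (∀ᶠ M in atTop, h (p M) < 0) →
      (HalfOpen p h x ↔ 0 < h x) ∧ (HalfOpen p (-h) x ↔ h x ≤ 0) := by
    intro h hneg
    refine ⟨⟨fun H => H.2 hneg, fun H => ⟨H.le, fun _ => H⟩⟩,
      ⟨fun H => by simpa using H.1, fun H => ⟨by simpa using H, fun H' => ?_⟩⟩⟩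
    obtain ⟨M, h1, h2⟩ := (hneg.and H').exists
    rw [LinearMap.neg_apply] at h2
    omega
  rcases hp.trichotomy g with h | h | h
  · rw [(key g h).1, (key g h).2, not_lt]
  · have := key (-g) (h.mono fun M hM => by simpa using hM)
    rw [neg_neg] at this
    rw [this.1, this.2]
    simp
  · exact absurd h hg

end HalfOpen

/-! ### The cone of scaled flows and its subdivision into unit boxes -/

section Flow

variable {E U : Type*}

/-- The scale of a scaled flow. -/
def scale : ℤ × (E → ℤ) →ₗ[ℤ] ℤ := LinearMap.fst ℤ ℤ (E → ℤ)

/-- The flow on an edge. -/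
def onEdge (e : E) : ℤ × (E → ℤ) →ₗ[ℤ] ℤ := LinearMap.proj e ∘ₗ LinearMap.snd ℤ ℤ (E → ℤ)

@[simp] theorem scale_apply (x : ℤ × (E → ℤ)) : scale x = x.1 := rfl

@[simp] theorem onEdge_apply (e : E) (x : ℤ × (E → ℤ)) : onEdge e x = x.2 e := rfl

/-- The forms cutting out `a e ≤ m e / N ≤ b e`. -/
def boxForm (a b : E → ℤ) : Option (E ⊕ E) → (ℤ × (E → ℤ) →ₗ[ℤ] ℤ)
  | none => scale
  | some (Sum.inl e) => onEdge e - a e • scale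
  | some (Sum.inr e) => b e • scale - onEdge e

theorem forall_boxForm {a b : E → ℤ} {P : (ℤ × (E → ℤ) →ₗ[ℤ] ℤ) → Prop} :
    (∀ i, P (boxForm a b i)) ↔
      P scale ∧ (∀ e, P (onEdge e - a e • scale)) ∧ ∀ e, P (b e • scale - onEdge e) := by
  constructor
  · exact fun h => ⟨h none, fun e => h (some (Sum.inl e)), fun e => h (some (Sum.inr e))⟩
  · rintro ⟨h1, h2, h3⟩ (_ | e | e)
    · exact h1
    · exact h2 e
    · exact h3 e

variable [Fintype E]

/-- The total flow. -/
def total : ℤ × (E → ℤ) →ₗ[ℤ] ℤ := ∑ e, onEdge e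

@[simp] theorem total_apply (x : ℤ × (E → ℤ)) : total x = ∑ e, x.2 e := by simp [total]

variable [DecidableEq U] (s t : E → U) (γ : U → ℤ)

/-- The pairs `(N, m)` with `m` an integral flow with net flow `N γ`. -/
def flowLattice : Submodule ℤ (ℤ × (E → ℤ)) where
  carrier := {x | ∀ u, ∑ e, x.2 e * incidence s t e u = x.1 * γ u}
  zero_mem' := by intro u; simp
  add_mem' := by
    intro x y hx hy u
    simp [add_mul, Finset.sum_add_distrib, hx u, hy u]
  smul_mem' := by
    intro c x hx u
    simp [mul_assoc, ← Finset.mul_sum, hx u]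

/-- The pairs `(N, m)` with `N ≥ 0` and `m` a non-negative integral flow with net flow `N γ`. -/
def flowCone : Set (ℤ × (E → ℤ)) :=
  {x | x ∈ flowLattice s t γ ∧ 0 ≤ x.1 ∧ ∀ e, 0 ≤ x.2 e}

/-- The scaled flows vanishing wherever all those in the flow cone do. -/
def flowSpan : Submodule ℤ (ℤ × (E → ℤ)) where
  carrier := {x | x ∈ flowLattice s t γ ∧ ((∀ y ∈ flowCone s t γ, y.1 = 0) → x.1 = 0) ∧
    ∀ e, (∀ y ∈ flowCone s t γ, y.2 e = 0) → x.2 e = 0}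
  zero_mem' := ⟨zero_mem _, by simp, by simp⟩
  add_mem' := by
    intro x y hx hy
    exact ⟨add_mem hx.1 hy.1, fun h => by simp [hx.2.1 h, hy.2.1 h],
      fun e h => by simp [hx.2.2 e h, hy.2.2 e h]⟩
  smul_mem' := by
    intro c x hx
    exact ⟨Submodule.smul_mem _ c hx.1, fun h => by simp [hx.2.1 h],
      fun e h => by simp [hx.2.2 e h]⟩

variable {s t γ}

theorem flowCone_subset_flowSpan {x : ℤ × (E → ℤ)} (hx : x ∈ flowCone s t γ) :
    x ∈ flowSpan s t γ := ⟨hx.1, fun h => h x hx, fun _ h => h x hx⟩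

theorem sum_mem_flowCone {κ : Type*} (I : Finset κ) (y : κ → ℤ × (E → ℤ))
    (hy : ∀ i, y i ∈ flowCone s t γ) : ∑ i ∈ I, y i ∈ flowCone s t γ := by
  refine ⟨sum_mem fun i _ => (hy i).1, ?_, fun e => ?_⟩
  · rw [Prod.fst_sum]; exact Finset.sum_nonneg fun i _ => (hy i).2.1
  · rw [Prod.snd_sum, Finset.sum_apply]; exact Finset.sum_nonneg fun i _ => (hy i).2.2 e

theorem zero_mem_flowCone : (0 : ℤ × (E → ℤ)) ∈ flowCone s t γ :=
  ⟨zero_mem _, le_rfl, fun _ => le_rfl⟩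

/-- A relative interior point of the flow cone. -/
theorem exists_interior : ∃ c ∈ flowCone s t γ,
    ((∀ y ∈ flowCone s t γ, y.1 = 0) ∨ 0 < c.1) ∧
    ∀ e, (∀ y ∈ flowCone s t γ, y.2 e = 0) ∨ 0 < c.2 e := by
  have h : ∀ i : Option E, ∃ y ∈ flowCone s t γ,
      (∀ x ∈ flowCone s t γ, i.elim (scale x) (fun e => onEdge e x) = 0) ∨
        0 < i.elim (scale y) (fun e => onEdge e y) := by
    intro i
    by_cases hi : ∀ x ∈ flowCone s t γ, i.elim (scale x) (fun e => onEdge e x) = 0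
    · exact ⟨0, zero_mem_flowCone, Or.inl hi⟩
    · push Not at hi
      obtain ⟨y, hy, hne⟩ := hi
      refine ⟨y, hy, Or.inr (lt_of_le_of_ne ?_ hne.symm)⟩
      cases i with
      | none => exact hy.2.1
      | some e => exact hy.2.2 e
  choose y hy hpos using h
  refine ⟨∑ i, y i, sum_mem_flowCone _ _ hy, ?_, fun e => ?_⟩
  · refine (hpos none).imp id fun h => ?_
    rw [Prod.fst_sum]
    exact Finset.sum_pos' (fun i _ => (hy i).2.1) ⟨none, Finset.mem_univ _, h⟩
  · refine (hpos (some e)).imp id fun h => ?_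
    rw [Prod.snd_sum, Finset.sum_apply]
    exact Finset.sum_pos' (fun i _ => (hy i).2.2 e) ⟨some e, Finset.mem_univ _, h⟩

variable [Fintype U]

/-- Flows in an acyclic graph are bounded. -/
theorem exists_flow_bound {ψ : U → ℤ} (hψ : ∀ e, ψ (s e) < ψ (t e)) :
    ∃ B : ℤ, 0 < B ∧ ∀ x ∈ flowCone s t γ, ∀ e, x.2 e ≤ B * x.1 := by
  -- Pairing net flows with the potential `ψ` computes `∑ m e (ψ (t e) - ψ (s e))`, whose terms
  -- dominate the `m e`. The maximum with `1` keeps `B` positive, so that the box is non-degenerate.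
  refine ⟨max 1 (-∑ u, ψ u * γ u), by positivity, fun x hx e => ?_⟩
  have h1 : ∑ e, x.2 e * (ψ (t e) - ψ (s e)) = (-∑ u, ψ u * γ u) * x.1 := by
    have h2 : ∑ u, ψ u * ∑ e, x.2 e * incidence s t e u = ∑ u, ψ u * (x.1 * γ u) :=
      Finset.sum_congr rfl fun u _ => by rw [hx.1 u]
    have h3 : ∀ e, ∑ u, ψ u * (x.2 e * incidence s t e u) =
        -(x.2 e * (ψ (t e) - ψ (s e))) := by
      intro e
      simp only [incidence, mul_sub, mul_ite, mul_one, mul_zero, Finset.sum_sub_distrib,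
        Finset.sum_ite_eq, Finset.mem_univ, if_true]
      ring
    simp only [Finset.mul_sum] at h2
    rw [Finset.sum_comm, Finset.sum_congr rfl fun e _ => h3 e, Finset.sum_neg_distrib] at h2
    rw [neg_mul, Finset.sum_mul, ← neg_eq_iff_eq_neg, h2]
    exact Finset.sum_congr rfl fun u _ => by ring
  calc x.2 e ≤ x.2 e * (ψ (t e) - ψ (s e)) :=
        le_mul_of_one_le_right (hx.2.2 e) (by have := hψ e; omega)
    _ ≤ ∑ e, x.2 e * (ψ (t e) - ψ (s e)) :=
        Finset.single_le_sum (f := fun e => x.2 e * (ψ (t e) - ψ (s e)))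
          (fun e _ => mul_nonneg (hx.2.2 e) (by have := hψ e; omega)) (Finset.mem_univ e)
    _ ≤ _ := by rw [h1]; exact mul_le_mul_of_nonneg_right (le_max_right _ _) hx.2.1

theorem box_enumerable {L : Submodule ℤ (ℤ × (E → ℤ))} {a b : E → ℤ} (ha : ∀ e, 0 ≤ a e) :
    Enumerable scale total {x | x ∈ L ∧ ∀ i, 0 ≤ boxForm a b i x} := by
  classical
  have key : ∀ x ∈ {x | x ∈ L ∧ ∀ i, 0 ≤ boxForm a b i x}, 0 ≤ x.1 ∧ (∀ e, 0 ≤ x.2 e) ∧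
      ∀ e, x.2 e ≤ b e * x.1 := by
    rintro x ⟨-, hx⟩
    rw [forall_boxForm (P := fun g => 0 ≤ g x)] at hx
    obtain ⟨h1, h2, h3⟩ := hx
    simp only [scale_apply, LinearMap.sub_apply, LinearMap.smul_apply, smul_eq_mul,
      onEdge_apply] at h1 h2 h3
    refine ⟨h1, fun e => ?_, fun e => by linarith [h3 e]⟩
    have := h2 e
    have := mul_nonneg (ha e) h1
    linarith
  refine ⟨fun N => ?_, fun x hx => (key x hx).1, fun x hx => ?_⟩
  · refine (Set.finite_Icc ((N : ℤ), (0 : E → ℤ)) ((N : ℤ), fun e => b e * N)).subset ?_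
    rintro ⟨_, m⟩ ⟨hx, rfl⟩
    obtain ⟨-, h2, h3⟩ := key _ hx
    exact ⟨⟨le_rfl, h2⟩, ⟨le_rfl, h3⟩⟩
  · rw [total_apply]
    exact Finset.sum_nonneg fun e _ => (key x hx).2.1 e

/-- Integrality of the faces of the polytopes of flows with integral bounds. -/
theorem box_integrality (hst : ∀ e, s e ≠ t e) {a : E → ℤ}
    (T : Set (Option (E ⊕ E)))
    (hT : ∃ x ∈ flowSpan s t γ, x ≠ 0 ∧ (∀ i, 0 ≤ boxForm a (fun e => a e + 1) i x) ∧
      ∀ i ∈ T, boxForm a (fun e => a e + 1) i x = 0) :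
    ∃ v ∈ flowSpan s t γ, scale v = 1 ∧
      (∀ i, boxForm a (fun e => a e + 1) i v = 0 ∨ boxForm a (fun e => a e + 1) i v = 1) ∧
      ∀ i ∈ T, boxForm a (fun e => a e + 1) i v = 0 := by
  obtain ⟨⟨N, m⟩, hL, hx0, hx, hxT⟩ := hT
  rw [forall_boxForm (P := fun g => 0 ≤ g (N, m))] at hx
  obtain ⟨h1, h2, h3⟩ := hx
  simp only [scale_apply, LinearMap.sub_apply, LinearMap.smul_apply, smul_eq_mul,
    onEdge_apply] at h1 h2 h3
  have hN : 0 < N := by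
    refine lt_of_le_of_ne h1 ?_
    rintro rfl
    refine hx0 (Prod.ext rfl (funext fun e => ?_))
    have := h2 e
    have := h3 e
    simp at *
    omega
  have hNQ : (0 : ℚ) < N := by exact_mod_cast hN
  -- The flow `m / N` is rounded. Integral bounds survive, so tight constraints stay tight, edges
  -- with zero flow keep it, and width one leaves only the slacks `0` and `1`.
  obtain ⟨m', hm', hr⟩ := exists_integral_flow hst γ (fun e => (m e : ℚ) / N) (by
    intro u
    have h := congrArg (Int.cast (R := ℚ)) (hL.1 u)
    push_cast at h
    simp only [div_mul_eq_mul_div]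
    rw [← Finset.sum_div, h]
    field_simp)
  have hle : ∀ e j, j * N ≤ m e → j ≤ m' e := by
    intro e j h
    refine (hr e j).1 ?_
    rw [le_div_iff₀ hNQ]
    exact_mod_cast h
  have hge : ∀ e j, m e ≤ j * N → m' e ≤ j := by
    intro e j h
    refine (hr e j).2 ?_
    rw [div_le_iff₀ hNQ]
    exact_mod_cast h
  have hl : ∀ e, a e ≤ m' e := fun e => hle e _ (by linarith [h2 e])
  have hu : ∀ e, m' e ≤ a e + 1 := fun e => hge e _ (by linarith [h3 e])
  refine ⟨(1, m'), ⟨fun u => ?_, fun h => ?_, fun e h => ?_⟩, rfl, ?_, ?_⟩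
  · simpa using hm' u
  · exact absurd (hL.2.1 h) hN.ne'
  · have h4 : m e = 0 := hL.2.2 e h
    exact le_antisymm (hge e 0 (by simp [h4])) (hle e 0 (by simp [h4]))
  · rw [forall_boxForm (P := fun g => g (1, m') = 0 ∨ g (1, m') = 1)]
    simp only [scale_apply, LinearMap.sub_apply, LinearMap.smul_apply, smul_eq_mul,
      onEdge_apply]
    refine ⟨Or.inr trivial, fun e => ?_, fun e => ?_⟩
    · have := hl e; have := hu e; omega
    · have := hl e; have := hu e; omega
  · intro i hi
    have h4 := hxT i hi
    rcases i with _ | e | e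
    · exact absurd h4 hN.ne'
    · simp only [boxForm, scale_apply, LinearMap.sub_apply, LinearMap.smul_apply, smul_eq_mul,
        onEdge_apply] at h4 ⊢
      have := hge e (a e) (by linarith)
      have := hl e
      omega
    · simp only [boxForm, scale_apply, LinearMap.sub_apply, LinearMap.smul_apply, smul_eq_mul,
        onEdge_apply] at h4 ⊢
      have := hle e (a e + 1) (by linarith)
      have := hu e
      omega

/-- Induction on the total excess width: a box wider than one along `e` is cut at `m e = (a e + 1)
N`, with `p` assigning the wall to one side. All pieces are taken in the same lattice, so `D` does
not change. -/
theorem latticeSeries_box_mem (hst : ∀ e, s e ≠ t e) {p : ℕ → ℤ × (E → ℤ)}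
    (hp : IsGeneric (flowSpan s t γ) p) :
    ∀ (k : ℕ) (a b : E → ℤ), (∀ e, 0 ≤ a e) → (∀ e, a e < b e) →
      ∑ e, (b e - a e - 1).toNat = k →
      latticeSeries scale total (halfOpenCone (flowSpan s t γ) p (boxForm a b)) ∈
        shellSeries (Module.finrank ℤ (flowSpan s t γ)) := by
  classical
  intro k
  induction k using Nat.strong_induction_on with
  | _ k ih =>
    intro a b ha hab hk
    by_cases hb : ∀ e, b e = a e + 1
    · obtain rfl : b = fun e => a e + 1 := funext hb
      refine latticeSeries_halfOpenCone_mem scale total _ _ _ p rfl hp ?_ (box_enumerable ha)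
        (box_integrality hst)
      intro x _ hx
      rw [forall_boxForm (P := fun g => g x = 0)] at hx
      obtain ⟨h1, h2, -⟩ := hx
      rw [scale_apply] at h1
      simp only [scale_apply, LinearMap.sub_apply, LinearMap.smul_apply, smul_eq_mul,
        onEdge_apply, h1, mul_zero, sub_zero] at h2
      exact Prod.ext h1 (funext h2)
    · push Not at hb
      obtain ⟨e, he⟩ := hb
      have hab' := hab e
      have hsum : ∀ a' b' : E → ℤ, (∀ e', (b' e' - a' e' - 1).toNat ≤ (b e' - a e' - 1).toNat) →
          (b' e - a' e - 1).toNat < (b e - a e - 1).toNat →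
          ∑ e, (b' e - a' e - 1).toNat < k := by
        intro a' b' h1 h2
        rw [← hk]
        exact Finset.sum_lt_sum (fun e' _ => h1 e') ⟨e, Finset.mem_univ _, h2⟩
      have hup := ih _ (hsum (Function.update a e (a e + 1)) b
        (fun e' => by
          by_cases h : e' = e
          · subst h; simp; omega
          · simp [h]) (by simp; omega)) (Function.update a e (a e + 1)) b
        (fun e' => by
          by_cases h : e' = e
          · subst h; have := ha e'; simp; omega
          · simpa [h] using ha e')
        (fun e' => by
          by_cases h : e' = e
          · subst h; simp; omega
          · simpa [h] using hab e') rfl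
      have hlow := ih _ (hsum a (Function.update b e (a e + 1))
        (fun e' => by
          by_cases h : e' = e
          · subst h; simp
          · simp [h]) (by simp; omega)) a (Function.update b e (a e + 1)) ha
        (fun e' => by
          by_cases h : e' = e
          · subst h; simp
          · simpa [h] using hab e') rfl
      have emono : ∀ {x : ℤ × (E → ℤ)}, HalfOpen p scale x →
          HalfOpen p (onEdge e - (a e + 1) • scale) x → HalfOpen p (onEdge e - a e • scale) x := by
        intro x h1 h2
        have := h2.add hp h1
        rwa [add_smul, one_smul, sub_add_eq_sub_sub, sub_add_cancel] at this
      have emono' : ∀ {x : ℤ × (E → ℤ)}, HalfOpen p scale x →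
          HalfOpen p ((a e + 1) • scale - onEdge e) x →
          HalfOpen p (b e • scale - onEdge e) x := by
        intro x h1 h2
        have := h2.add hp (h1.smul (k := b e - (a e + 1)) (by omega))
        convert this using 1
        rw [sub_smul]; abel
      have hmem : ∀ {a' b' : E → ℤ} {x}, x ∈ halfOpenCone (flowSpan s t γ) p (boxForm a' b') ↔
          x ∈ flowSpan s t γ ∧ HalfOpen p scale x ∧
            (∀ e, HalfOpen p (onEdge e - a' e • scale) x) ∧
            ∀ e, HalfOpen p (b' e • scale - onEdge e) x := by
        intro a' b' x
        rw [← forall_boxForm (P := fun g => HalfOpen p g x)]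
        rfl
      have hmemup : ∀ {x}, x ∈ halfOpenCone (flowSpan s t γ) p
            (boxForm (Function.update a e (a e + 1)) b) ↔
          x ∈ halfOpenCone (flowSpan s t γ) p (boxForm a b) ∧
            HalfOpen p (onEdge e - (a e + 1) • scale) x := by
        intro x
        rw [hmem, hmem]
        constructor
        · rintro ⟨h1, h2, h3, h4⟩
          have h5 := h3 e
          rw [Function.update_self] at h5
          refine ⟨⟨h1, h2, fun e' => ?_, h4⟩, h5⟩
          by_cases h : e' = e
          · subst h; exact emono h2 h5
          · have := h3 e'
            rwa [Function.update_of_ne h] at this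
        · rintro ⟨⟨h1, h2, h3, h4⟩, h5⟩
          refine ⟨h1, h2, fun e' => ?_, h4⟩
          by_cases h : e' = e
          · subst h; rwa [Function.update_self]
          · rw [Function.update_of_ne h]; exact h3 e'
      have hmemlow : ∀ {x}, x ∈ halfOpenCone (flowSpan s t γ) p
            (boxForm a (Function.update b e (a e + 1))) ↔
          x ∈ halfOpenCone (flowSpan s t γ) p (boxForm a b) ∧
            HalfOpen p (-(onEdge e - (a e + 1) • scale)) x := by
        intro x
        rw [hmem, hmem, neg_sub]
        constructor
        · rintro ⟨h1, h2, h3, h4⟩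
          have h5 := h4 e
          rw [Function.update_self] at h5
          refine ⟨⟨h1, h2, h3, fun e' => ?_⟩, h5⟩
          by_cases h : e' = e
          · subst h; exact emono' h2 h5
          · have := h4 e'
            rwa [Function.update_of_ne h] at this
        · rintro ⟨⟨h1, h2, h3, h4⟩, h5⟩
          refine ⟨h1, h2, h3, fun e' => ?_⟩
          by_cases h : e' = e
          · subst h; rwa [Function.update_self]
          · rw [Function.update_of_ne h]; exact h4 e'
      -- If the cutting form vanishes on the lattice, the wall is everything and the upper box is
      -- the whole; otherwise the two half-open parts are complementary.
      by_cases hv : ∀ x ∈ flowSpan s t γ, (onEdge e - (a e + 1) • scale : ℤ × (E → ℤ) →ₗ[ℤ] ℤ) x = 0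
      · have : halfOpenCone (flowSpan s t γ) p (boxForm a b) = halfOpenCone (flowSpan s t γ) p
            (boxForm (Function.update a e (a e + 1)) b) := by
          ext x
          rw [hmemup]
          exact ⟨fun h => ⟨h, HalfOpen.of_vanish hp hv h.1⟩, fun h => h.1⟩
        rwa [this]
      · have hunion : halfOpenCone (flowSpan s t γ) p (boxForm a b) =
            halfOpenCone (flowSpan s t γ) p (boxForm (Function.update a e (a e + 1)) b) ∪
            halfOpenCone (flowSpan s t γ) p (boxForm a (Function.update b e (a e + 1))) := by
          ext x
          rw [Set.mem_union, hmemup, hmemlow, halfOpen_neg_iff hp hv, ← and_or_left,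
            and_iff_left (em _)]
        have hen : Enumerable scale total
            (halfOpenCone (flowSpan s t γ) p (boxForm a b)) :=
          (box_enumerable ha).mono fun x hx => ⟨hx.1, fun i => (hx.2 i).1⟩
        rw [hunion, latticeSeries_union (hen.mono fun x hx => (hmemup.1 hx).1)
          (hen.mono fun x hx => (hmemlow.1 hx).1)]
        · exact add_mem hup hlow
        · rw [Set.disjoint_left]
          intro x h1 h2
          rw [hmemlow, halfOpen_neg_iff hp hv] at h2
          exact h2.2 (hmemup.1 h1).2

theorem flowCone_enumerable {ψ : U → ℤ} (hψ : ∀ e, ψ (s e) < ψ (t e)) :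
    Enumerable scale total (flowCone s t γ) := by
  obtain ⟨B, -, hB⟩ := exists_flow_bound (s := s) (t := t) (γ := γ) hψ
  refine (box_enumerable (L := ⊤) (a := fun _ => 0) (b := fun _ => B) fun _ => le_rfl).mono
    fun x hx => ⟨trivial, ?_⟩
  rw [forall_boxForm (P := fun g => 0 ≤ g x)]
  exact ⟨hx.2.1, fun e => by simpa using hx.2.2 e, fun e => by simpa using hB x hx e⟩

/-- The series enumerating the scaled flows in an acyclic graph is a sum of the series of half-open
unimodular simplicial cones of one dimension. -/
theorem latticeSeries_flowCone_mem {ψ : U → ℤ} (hψ : ∀ e, ψ (s e) < ψ (t e)) :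
    latticeSeries scale total (flowCone s t γ) ∈
      shellSeries (Module.finrank ℤ (flowSpan s t γ)) := by
  obtain ⟨c, hc, hc1, hc2⟩ := exists_interior (s := s) (t := t) (γ := γ)
  obtain ⟨p, hp, hpc⟩ := exists_isGeneric (flowSpan s t γ) (flowCone_subset_flowSpan hc)
  obtain ⟨B, hB, hBx⟩ := exists_flow_bound (s := s) (t := t) (γ := γ) hψ
  have hp1 : ∀ᶠ M in atTop, 0 ≤ (p M).1 := by
    rcases hc1 with h | h
    · exact Eventually.of_forall fun M => ((hp.mem M).2.1 h).ge
    · exact (hpc scale h).mono fun M h => h.le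
  have hp2 : ∀ᶠ M in atTop, ∀ e, 0 ≤ (p M).2 e := by
    rw [eventually_all]
    intro e
    rcases hc2 e with h | h
    · exact Eventually.of_forall fun M => ((hp.mem M).2.2 e h).ge
    · exact (hpc (onEdge e) h).mono fun M h => h.le
  have hpC : ∀ᶠ M in atTop, p M ∈ flowCone s t γ :=
    (hp1.and hp2).mono fun M h => ⟨(hp.mem M).1, h⟩
  -- Since `p` approaches an interior direction, it is eventually in the flow cone. A form
  -- non-negative on the cone is then never eventually negative along `p`, so no wall is removed and
  -- the half-open cone is the closed one.
  have hHO : ∀ g : ℤ × (E → ℤ) →ₗ[ℤ] ℤ, (∀ x ∈ flowCone s t γ, 0 ≤ g x) →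
      ∀ x ∈ flowCone s t γ, HalfOpen p g x := by
    intro g hg x hx
    refine ⟨hg x hx, fun h => ?_⟩
    obtain ⟨M, h1, h2⟩ := (h.and hpC).exists
    exact absurd (hg _ h2) h1.not_ge
  have heq : flowCone s t γ =
      halfOpenCone (flowSpan s t γ) p (boxForm (fun _ => 0) (fun _ => B)) := by
    ext x
    constructor
    · refine fun hx => ⟨flowCone_subset_flowSpan hx, fun i => hHO _ (fun y hy => ?_) x hx⟩
      rcases i with _ | e | e
      · exact hy.2.1
      · simpa [boxForm] using hy.2.2 e
      · simpa [boxForm] using hBx y hy e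
    · rintro ⟨hL, hx⟩
      refine ⟨hL.1, (hx none).1, fun e => ?_⟩
      simpa [boxForm] using (hx (some (Sum.inl e))).1
  rw [heq]
  refine latticeSeries_box_mem (fun e h => ?_) hp _ _ _ (fun _ => le_rfl) (fun _ => hB) rfl
  have := hψ e
  rw [h] at this
  exact lt_irrefl _ this

end Flow

/-! ### Reduced fractions and the specialization `q = 1` -/

section Rational

/-- The substitution `q = 1`. -/
def evalOne : PowerSeries ℤ[X] →+* PowerSeries ℤ := PowerSeries.map (evalRingHom 1)

@[simp] theorem coeff_evalOne (N : ℕ) (H : PowerSeries ℤ[X]) :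
    PowerSeries.coeff N (evalOne H) = (PowerSeries.coeff N H).eval 1 := rfl

@[simp] theorem evalOne_geomFactor (j : ℕ) : evalOne (geomFactor j) = 1 - PowerSeries.X := by
  simp [evalOne, geomFactor]

theorem evalOne_prod_geomFactor (σ : Multiset ℕ) :
    evalOne (σ.map geomFactor).prod = (1 - PowerSeries.X) ^ Multiset.card σ := by
  rw [map_multiset_prod, Multiset.map_map]
  simp

theorem evalOne_C_mul_X_pow (a b : ℕ) :
    evalOne (PowerSeries.C (X ^ b : ℤ[X]) * PowerSeries.X ^ a) = PowerSeries.X ^ a := by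
  simp [evalOne]

/-- The factor `1 - q ^ j t` as a polynomial. -/
def polyFactor (j : ℕ) : ℤ[X][X] := 1 - C ((X : ℤ[X]) ^ j) * X

@[simp] theorem coe_polyFactor (j : ℕ) : (polyFactor j : PowerSeries ℤ[X]) = geomFactor j := by
  simp [polyFactor, geomFactor]

theorem coe_prod_polyFactor (σ : Multiset ℕ) :
    ((σ.map polyFactor).prod : PowerSeries ℤ[X]) = (σ.map geomFactor).prod := by
  rw [← Polynomial.coeToPowerSeries.ringHom_apply, map_multiset_prod, Multiset.map_map]
  exact congrArg _ (Multiset.map_congr rfl fun j _ => coe_polyFactor j)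

/-- The polynomial is linear in `t` with coprime coefficients, one of them being `1`. -/
theorem irreducible_polyFactor (j : ℕ) : Irreducible (polyFactor j) := by
  have h : polyFactor j = C (-(X : ℤ[X]) ^ j) * X + C 1 := by
    simp [polyFactor]; ring
  rw [h]
  exact irreducible_C_mul_X_add_C (by simp) isRelPrime_one_right

theorem polyFactor_coeff_zero (j : ℕ) : (polyFactor j).coeff 0 = 1 := by
  simp [polyFactor]

theorem prod_polyFactor_coeff_zero (σ : Multiset ℕ) : (σ.map polyFactor).prod.coeff 0 = 1 := by
  rw [← constantCoeff_apply, map_multiset_prod, Multiset.map_map]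
  simp [polyFactor_coeff_zero]

theorem exists_prod_geomFactor_mul {D : ℕ} {H : PowerSeries ℤ[X]} (hH : H ∈ shellSeries D) :
    ∃ (σ : Multiset ℕ) (P : ℤ[X][X]), (σ.map geomFactor).prod * H = P := by
  induction hH using AddSubmonoid.closure_induction with
  | mem H h =>
    obtain ⟨σ, a, b, -, -, h⟩ := h
    exact ⟨σ, C (X ^ b) * X ^ a, by rw [h]; simp⟩
  | zero => exact ⟨0, 0, by simp⟩
  | add x y _ _ hx hy =>
    obtain ⟨σ, P, hx⟩ := hx
    obtain ⟨τ, R, hy⟩ := hy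
    refine ⟨σ + τ, (τ.map polyFactor).prod * P + (σ.map polyFactor).prod * R, ?_⟩
    rw [Multiset.map_add, Multiset.prod_add, Polynomial.coe_add, Polynomial.coe_mul,
      Polynomial.coe_mul, coe_prod_polyFactor, coe_prod_polyFactor, ← hx, ← hy]
    ring

/-- At `q = 1` all denominators become the same `(1 - t) ^ D`, so numerators `t ^ a` add without
cancellation. -/
theorem exists_numerator_evalOne {D : ℕ} {H : PowerSeries ℤ[X]} (hH : H ∈ shellSeries D) :
    ∃ h : ℤ[X], (∀ k, 0 ≤ h.coeff k) ∧ (1 - PowerSeries.X) ^ D * evalOne H = (h : PowerSeries ℤ) := by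
  induction hH using AddSubmonoid.closure_induction with
  | mem H h =>
    obtain ⟨σ, a, b, rfl, -, h⟩ := h
    refine ⟨X ^ a, fun k => ?_, ?_⟩
    · rw [coeff_X_pow]; split_ifs <;> simp
    · rw [← evalOne_prod_geomFactor, ← map_mul, h, evalOne_C_mul_X_pow]; simp
  | zero => exact ⟨0, by simp, by simp⟩
  | add x y _ _ hx hy =>
    obtain ⟨h, h1, h2⟩ := hx
    obtain ⟨g, g1, g2⟩ := hy
    refine ⟨h + g, fun k => ?_, ?_⟩
    · rw [coeff_add]; exact add_nonneg (h1 k) (g1 k)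
    · rw [map_add, mul_add, h2, g2, Polynomial.coe_add]

theorem coeff_of_one_sub_X_pow_mul_eq {D a : ℕ} {G : PowerSeries ℤ}
    (hG : (1 - PowerSeries.X) ^ (D + 1) * G = PowerSeries.X ^ a) (N : ℕ) :
    PowerSeries.coeff N G = if a ≤ N then ((D + (N - a)).choose D : ℤ) else 0 := by
  have h := PowerSeries.mk_add_choose_mul_one_sub_pow_eq_one ℤ D
  have : G = PowerSeries.X ^ a * PowerSeries.mk fun n => ((D + n).choose D : ℤ) := by
    rw [← hG, mul_right_comm, mul_comm _ (PowerSeries.mk _), h, one_mul]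
  rw [this, PowerSeries.coeff_X_pow_mul']
  simp

theorem exists_polynomial_coeff_evalOne {D : ℕ} {H : PowerSeries ℤ[X]} (hH : H ∈ shellSeries D) :
    ∃ F : ℚ[X], ∀ N : ℕ, 1 ≤ N → F.eval (N : ℚ) = (PowerSeries.coeff N (evalOne H) : ℤ) := by
  induction hH using AddSubmonoid.closure_induction with
  | mem H h =>
    obtain ⟨σ, a, b, rfl, ha, h⟩ := h
    have h1 := congrArg evalOne h
    rw [map_mul, evalOne_prod_geomFactor, evalOne_C_mul_X_pow] at h1
    rcases hD : Multiset.card σ with _ | D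
    · rw [hD] at h1 ha
      obtain rfl : a = 0 := by omega
      refine ⟨0, fun N hN => ?_⟩
      rw [pow_zero, one_mul, pow_zero] at h1
      rw [h1, PowerSeries.coeff_one, if_neg (by omega)]
      simp
    · rw [hD] at h1 ha
      refine ⟨preHilbertPoly ℚ D a, fun N hN => ?_⟩
      rw [coeff_of_one_sub_X_pow_mul_eq h1]
      split_ifs with haN
      · rw [preHilbertPoly_eq_choose_sub_add ℚ D haN, add_comm]
        simp
      -- For `1 ≤ N < a ≤ D + 1` the binomial polynomial has a zero, matching the vanishing
      -- coefficient; this is where the bound on `a` is used.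
      · have h2 : eval ((N : ℚ) - a + 1) (ascPochhammer ℚ D) = 0 := by
          have : (N : ℚ) - a + 1 = -((a - N - 1 : ℕ) : ℚ) := by
            rw [Nat.cast_sub (by omega), Nat.cast_sub (by omega)]
            push_cast
            ring
          rw [this, ascPochhammer_eval_neg_coe_nat_of_lt (by omega)]
        simp [preHilbertPoly, h2]
  | zero => exact ⟨0, by simp⟩
  | add x y _ _ hx hy =>
    obtain ⟨F, hF⟩ := hx
    obtain ⟨G, hG⟩ := hy
    refine ⟨F + G, fun N hN => ?_⟩
    rw [eval_add, hF N hN, hG N hN, map_add, map_add, Int.cast_add]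

theorem exists_reduced_fraction {H : PowerSeries ℤ[X]}
    (hH : ∃ (σ : Multiset ℕ) (P : ℤ[X][X]), (σ.map geomFactor).prod * H = P) :
    ∃ (J : Multiset ℕ) (P : ℤ[X][X]), (J.map geomFactor).prod * H = P ∧
      IsRelPrime P (J.map polyFactor).prod := by
  classical
  -- A denominator with fewest factors is chosen. A common non-unit divisor would have an
  -- irreducible factor associated to some `1 - q ^ j t`, and cancelling that factor contradicts
  -- minimality.
  have hex : ∃ c, ∃ (σ : Multiset ℕ) (P : ℤ[X][X]), Multiset.card σ = c ∧
      (σ.map geomFactor).prod * H = P := by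
    obtain ⟨σ, P, h⟩ := hH
    exact ⟨_, σ, P, rfl, h⟩
  obtain ⟨J, P, hc, hP⟩ := Nat.find_spec hex
  refine ⟨J, P, hP, fun d hdP hdQ => ?_⟩
  by_contra hd
  have hd0 : d ≠ 0 := by
    rintro rfl
    have h := congrArg (fun f => coeff f 0) (zero_dvd_iff.1 hdQ)
    simp [prod_polyFactor_coeff_zero] at h
  obtain ⟨i, hi, hid⟩ := WfDvdMonoid.exists_irreducible_factor hd hd0
  obtain ⟨_, hjJ, hij⟩ := hi.prime.exists_mem_multiset_dvd (hid.trans hdQ)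
  obtain ⟨j, hj, rfl⟩ := Multiset.mem_map.1 hjJ
  have hjP : polyFactor j ∣ P :=
    (hi.associated_of_dvd (irreducible_polyFactor j) hij).symm.dvd.trans (hid.trans hdP)
  obtain ⟨R, rfl⟩ := hjP
  obtain ⟨J, rfl⟩ := Multiset.exists_cons_of_mem hj
  refine Nat.find_min hex (m := Multiset.card J) ?_ ⟨J, R, rfl, ?_⟩
  · rw [← hc]; simp
  · rw [Multiset.map_cons, Multiset.prod_cons, Polynomial.coe_mul, coe_polyFactor,
      mul_assoc] at hP
    refine mul_left_cancel₀ ?_ hP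
    intro h0
    have := geomFactor_mul_inv j
    simp [h0] at this

theorem rational_of_mem_shellSeries {D : ℕ} {H : PowerSeries ℤ[X]} (hH : H ∈ shellSeries D)
    (hH0 : PowerSeries.constantCoeff H = 1) :
    ∃ P Q : ℤ[X][X], IsRelPrime P Q ∧ (P.eval 0).eval 0 = 1 ∧
      (Q : PowerSeries ℤ[X]) * H = (P : PowerSeries ℤ[X]) ∧
      (∃ J : Multiset ℕ,
        Q = (J.map fun j => (1 - C ((X : ℤ[X]) ^ j) * X : ℤ[X][X])).prod) ∧
      ∃ (s : ℕ) (R : ℤ[X]), P.map (evalRingHom 1) = (1 - X) ^ s * R ∧ R.eval 1 ≠ 0 ∧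
        ∀ k, 0 ≤ R.coeff k := by
  obtain ⟨J, P, hP, hrel⟩ := exists_reduced_fraction (exists_prod_geomFactor_mul hH)
  obtain ⟨h, hnn, hh⟩ := exists_numerator_evalOne hH
  refine ⟨P, (J.map polyFactor).prod, hrel, ?_, by rw [coe_prod_polyFactor, hP], ⟨J, rfl⟩, ?_⟩
  · have h1 := congrArg PowerSeries.constantCoeff hP
    rw [map_mul, hH0, ← coe_prod_polyFactor, Polynomial.constantCoeff_coe,
      Polynomial.constantCoeff_coe,
      prod_polyFactor_coeff_zero, one_mul] at h1
    rw [← coeff_zero_eq_eval_zero P, ← h1, eval_one]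
  · have hX : (1 - PowerSeries.X : PowerSeries ℤ) ≠ 0 := by
      intro h0
      have := congrArg PowerSeries.constantCoeff h0
      simp at this
    have hne : evalOne H ≠ 0 := by
      intro h0
      have := congrArg PowerSeries.constantCoeff h0
      rw [← PowerSeries.coeff_zero_eq_constantCoeff_apply, coeff_evalOne,
        PowerSeries.coeff_zero_eq_constantCoeff_apply, hH0] at this
      simp at this
    have hh0 : h ≠ 0 := by
      rintro rfl
      rw [Polynomial.coe_zero] at hh
      exact mul_ne_zero (pow_ne_zero _ hX) hne hh
    have hh1 : h.eval 1 ≠ 0 := by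
      obtain ⟨k, hk⟩ : ∃ k, h.coeff k ≠ 0 := by
        by_contra! hcon
        exact hh0 (Polynomial.ext hcon)
      rw [eval_eq_sum, Polynomial.sum]
      simp only [one_pow, mul_one]
      exact (Finset.sum_pos' (fun i _ => hnn i)
        ⟨k, mem_support_iff.2 hk, lt_of_le_of_ne (hnn k) hk.symm⟩).ne'
    have hP1 : (1 - PowerSeries.X) ^ Multiset.card J * evalOne H =
        (P.map (evalRingHom 1) : PowerSeries ℤ) := by
      rw [← evalOne_prod_geomFactor, ← map_mul, hP]
      ext N
      simp [evalOne]
    -- With fewer than `D` factors in the denominator, `1 - t` would divide `h`, against `h(1) ≠ 0`.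
    -- The exponent is then `s = |J| - D`.
    have hJD : D ≤ Multiset.card J := by
      by_contra! hlt
      obtain ⟨e, rfl⟩ := Nat.exists_eq_add_of_lt hlt
      have h2 : h = (1 - X) ^ (e + 1) * P.map (evalRingHom 1) := by
        rw [← Polynomial.coe_inj, ← hh, Polynomial.coe_mul, ← hP1]
        simp only [Polynomial.coe_pow, Polynomial.coe_sub, Polynomial.coe_one, Polynomial.coe_X]
        ring
      rw [h2] at hh1
      simp at hh1
    obtain ⟨e, he⟩ := Nat.exists_eq_add_of_le hJD
    refine ⟨e, h, ?_, hh1, hnn⟩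
    rw [← Polynomial.coe_inj, ← hP1, he, Polynomial.coe_mul, ← hh]
    simp only [Polynomial.coe_pow, Polynomial.coe_sub, Polynomial.coe_one, Polynomial.coe_X]
    ring

end Rational

/-! ### The Kostant series as a count of flows -/

section Kostant

variable {n : ℕ} (η : Composition n)

theorem fst_lt_snd_of_mem_PhiFinset {e : Fin n × Fin n} (he : e ∈ PhiFinset η) : e.1 < e.2 := by
  simp only [PhiFinset, Finset.mem_filter] at he
  obtain ⟨-, r, -, -, h1, h2⟩ := he
  exact Fin.lt_def.2 (by omega)

/-- Both sides are inverse to `rootProduct η`. -/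
theorem kostantSeries_eq_prod :
    kostantSeries η = ∏ e : PhiFinset η, PowerSeries.mk fun k => ratio e.1 ^ k := by
  have h : rootProduct η * ∏ e : PhiFinset η, PowerSeries.mk (fun k => ratio e.1 ^ k) = 1 := by
    rw [rootProduct, ← Finset.prod_coe_sort, ← Finset.prod_mul_distrib]
    refine Finset.prod_eq_one fun e _ => ?_
    ext1 k
    rw [sub_mul, one_mul, mul_assoc, map_sub, PowerSeries.coeff_C_mul, PowerSeries.coeff_one]
    cases k with
    | zero => simp
    | succ k =>
      rw [PowerSeries.coeff_succ_X_mul]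
      simp [pow_succ']
  calc kostantSeries η = kostantSeries η *
        (rootProduct η * ∏ e : PhiFinset η, PowerSeries.mk (fun k => ratio e.1 ^ k)) := by
        rw [h, mul_one]
    _ = (rootProduct η * kostantSeries η) *
        ∏ e : PhiFinset η, PowerSeries.mk (fun k => ratio e.1 ^ k) := by ring
    _ = _ := by rw [rootProduct_mul_kostantSeries, one_mul]

theorem prod_ratio_pow (l : PhiFinset η → ℕ) :
    ∏ e, ratio e.1 ^ l e = (AddMonoidAlgebra.single
      (fun u => ∑ e : PhiFinset η, (l e : ℤ) *
        incidence (fun e : PhiFinset η => e.1.1) (fun e => e.1.2) e u) 1 : Laurent n) := by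
  classical
  have h : ∀ I : Finset (PhiFinset η), ∏ e ∈ I, ratio e.1 ^ l e = (AddMonoidAlgebra.single
      (∑ e ∈ I, l e • (Pi.single e.1.1 1 - Pi.single e.1.2 1)) 1 : Laurent n) := by
    intro I
    induction I using Finset.induction_on with
    | empty => simp [AddMonoidAlgebra.one_def]
    | insert e I he ih =>
      rw [Finset.prod_insert he, Finset.sum_insert he, ih, ratio, AddMonoidAlgebra.single_pow,
        AddMonoidAlgebra.single_mul_single, one_pow, one_mul]
  rw [h]
  congr 1
  ext u
  rw [Finset.sum_apply]
  refine Finset.sum_congr rfl fun e _ => ?_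
  simp [incidence, Pi.single_apply, eq_comm]

/-- The coefficients of the Kostant series count flows. -/
theorem coeff_kostantSeries (d : ℕ) (δ : Fin n → ℤ) :
    (PowerSeries.coeff d (kostantSeries η)).coeff δ =
      ((Finset.univ.finsuppAntidiag d : Finset (PhiFinset η →₀ ℕ)).filter fun l =>
        ∀ u, ∑ e : PhiFinset η, (l e : ℤ) *
          incidence (fun e : PhiFinset η => e.1.1) (fun e => e.1.2) e u = δ u).card := by
  classical
  rw [kostantSeries_eq_prod, PowerSeries.coeff_prod]
  simp only [PowerSeries.coeff_mk, prod_ratio_pow]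
  rw [AddMonoidAlgebra.coeff_sum, Finsupp.finsetSum_apply, Finset.card_filter, Nat.cast_sum]
  refine Finset.sum_congr rfl fun l _ => ?_
  rw [AddMonoidAlgebra.coeff_single, Finsupp.single_apply]
  simp only [← funext_iff]
  split_ifs <;> simp

theorem stretchedSeries_eq_latticeSeries (γ : Fin n → ℤ) :
    stretchedSeries η γ = latticeSeries scale total
      (flowCone (fun e : PhiFinset η => e.1.1) (fun e => e.1.2) γ) := by
  classical
  have hen : Enumerable scale total
      (flowCone (fun e : PhiFinset η => e.1.1) (fun e => e.1.2) γ) :=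
    flowCone_enumerable (ψ := fun u : Fin n => (u : ℤ)) fun e => by
      exact_mod_cast fst_lt_snd_of_mem_PhiFinset η e.2
  ext1 N
  ext1 d
  rw [stretchedSeries, latticeSeries, PowerSeries.coeff_mk, PowerSeries.coeff_mk,
    coeff_qKostant, coeff_kostantSeries, finsum_mem_eq_finite_toFinset_sum _ (hen.finite N),
    finsetSum_coeff]
  simp only [coeff_X_pow]
  rw [Finset.sum_boole, Nat.cast_inj]
  -- Multiplicities `l` of the pairs in `Φ(η)` with total `d` correspond to flows of scale `N`; the
  -- weight is the total flow, hence the degree in `q`.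
  refine Finset.card_bij (fun l _ => ((N : ℤ), fun e => (l e : ℤ))) ?_ ?_ ?_
  · intro l hl
    simp only [Finset.mem_filter, Finset.mem_finsuppAntidiag] at hl
    obtain ⟨⟨h1, -⟩, h2⟩ := hl
    rw [Finset.mem_filter, Set.Finite.mem_toFinset]
    refine ⟨⟨⟨fun u => by simpa using h2 u, by simp, fun e => by simp⟩, rfl⟩, ?_⟩
    rw [total_apply, ← h1]
    dsimp only
    rw [← Nat.cast_sum, Int.toNat_natCast]
  · intro l _ l' _ h
    ext e
    have := congrFun (Prod.ext_iff.1 h).2 e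
    dsimp only at this
    exact_mod_cast this
  · rintro ⟨M, m⟩ hx
    rw [Finset.mem_filter, Set.Finite.mem_toFinset] at hx
    obtain ⟨⟨⟨h1, -, h3⟩, h4⟩, h5⟩ := hx
    rw [scale_apply] at h4
    dsimp only at h3 h4
    subst h4
    have hm : ∀ e, ((m e).toNat : ℤ) = m e := fun e => Int.toNat_of_nonneg (h3 e)
    refine ⟨Finsupp.equivFunOnFinite.symm fun e => (m e).toNat, ?_, ?_⟩
    · rw [Finset.mem_filter, Finset.mem_finsuppAntidiag]
      refine ⟨⟨?_, Finset.subset_univ _⟩, fun u => ?_⟩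
      · rw [h5, total_apply]
        zify
        rw [Int.toNat_of_nonneg (Finset.sum_nonneg fun e _ => h3 e)]
        exact Finset.sum_congr rfl fun e _ => hm e
      · simpa [hm] using h1 u
    · exact Prod.ext rfl (funext fun e => by simpa using h3 e)

theorem constantCoeff_stretchedSeries (γ : Fin n → ℤ) :
    PowerSeries.constantCoeff (stretchedSeries η γ) = 1 := by
  rw [← PowerSeries.coeff_zero_eq_constantCoeff_apply, stretchedSeries, PowerSeries.coeff_mk,
    zero_smul]
  have h : PowerSeries.coeff 0 (kostantSeries η) = 1 := by
    rw [kostantSeries, PowerSeries.coeff_zero_eq_constantCoeff_apply,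
      PowerSeries.constantCoeff_invOfUnit]
    simp
  simp [qKostant, height, h, AddMonoidAlgebra.one_def, AddMonoidAlgebra.coeff_single]

end Kostant

end ParabolicKostant

end

/-- A polynomial in `q` and `t` is an element of `ℤ[X][X]`, with outer variable `t` and inner
variable `q`. -/
theorem theorem3p17 {n : ℕ} (η : Composition n) (γ : Fin n → ℤ)
    (hγ : γ ∈ ParabolicKostant.Y η) :
    (∃ P Q : ℤ[X][X],
      IsRelPrime P Q ∧
      (P.eval 0).eval 0 = 1 ∧
      (Q : PowerSeries ℤ[X]) * ParabolicKostant.stretchedSeries η γ = (P : PowerSeries ℤ[X]) ∧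
      (∃ J : Multiset ℕ,
        Q = (J.map fun j => (1 - Polynomial.C ((Polynomial.X : ℤ[X]) ^ j) * Polynomial.X :
          ℤ[X][X])).prod) ∧
      ∃ (s : ℕ) (R : ℤ[X]),
        P.map (Polynomial.evalRingHom 1) = (1 - Polynomial.X) ^ s * R ∧
        R.eval 1 ≠ 0 ∧
        ∀ k, 0 ≤ R.coeff k) ∧
    ∃ F : ℚ[X], ∀ N : ℕ, 1 ≤ N → F.eval (N : ℚ) = (ParabolicKostant.kostant η (N • γ) : ℚ) := by
  have hmem := ParabolicKostant.latticeSeries_flowCone_mem (γ := γ)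
    (s := fun e : ParabolicKostant.PhiFinset η => e.1.1) (t := fun e => e.1.2)
    (ψ := fun u : Fin n => (u : ℤ)) fun e => by
      exact_mod_cast ParabolicKostant.fst_lt_snd_of_mem_PhiFinset η e.2
  rw [← ParabolicKostant.stretchedSeries_eq_latticeSeries] at hmem
  refine ⟨ParabolicKostant.rational_of_mem_shellSeries hmem
    (ParabolicKostant.constantCoeff_stretchedSeries η γ), ?_⟩
  obtain ⟨F, hF⟩ := ParabolicKostant.exists_polynomial_coeff_evalOne hmem
  refine ⟨F, fun N hN => ?_⟩
  rw [hF N hN, ParabolicKostant.coeff_evalOne, ParabolicKostant.stretchedSeries,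
    PowerSeries.coeff_mk, ParabolicKostant.kostant]
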